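/- Fix a local dimension $d$. There is a function $C:\mathbb N\to\mathbb R$ (depending only on $d$) such that the following holds for every chain of $n$ spins of local dimension $d$, every integer $D\ge 1$ and every normalized state $|\psi\rangle\in(\mathbb C^d)^{\otimes n}$. For each cut of the chain into the spins $1,\dots,k-1$ and $k,\dots,n$, let $\lambda^{[k]}_1\ge\lambda^{[k]}_2\ge\cdots\ge0$ be the Schmidt coefficients of $|\psi\rangle$ across this cut, and put $$\varepsilon_D:=\max_k\sum_{j\ge D+1}\bigl(\lambda^{[k]}_j\bigr)^2 .$$ A matrix product operator (MPO) with bond sizes $D_1,\dots,D_{n+1}\ge1$, $D_1=D_{n+1}=1$, is an operator of the form $$\sum_{i_1,j_1,\dots,i_n,j_n=1}^{d}\Bigl(B^{[1]}_{i_1,j_1}B^{[2]}_{i_2,j_2}\cdots B^{[n]}_{i_n,j_n}\Bigr)\,|i_1i_2\cdots i_n\rangle\langle j_1j_2\cdots j_n|,$$ where $B^{[k]}_{i,j}$ is a complex $D_k\times D_{k+1}$ matrix; its bond dimension is $\max_k D_k$. Then there is a positive semidefinite operator $\rho_D$ given by an MPO of bond dimension at most $D^2$ (exactly $D^2$ if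 $n\ge2$) such that, for every $\ell$ and every operator $\hat O$ acting nontrivially only on $\ell$ consecutive spins, $$\bigl|\langle\psi|\hat O|\psi\rangle-\operatorname{tr}(\rho_D\hat O)\bigr|\le C(\ell)\,\|\hat O\|\,\sqrt{\varepsilon_D},$$ where $\|\cdot\|$ is the operator norm. In particular the error is $O(\sqrt{\varepsilon_D})$ for all local operators of bounded norm, with a constant independent of $n$, $D$ and $|\psi\rangle$. -/

import Mathlib

open scoped ComplexOrder

/-- Computational basis configurations of a chain of `n` spins of local dimension `d`. -/
abbrev SpinConfig (n d : ℕ) : Type := Fin n → Fin d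

/-- The Hilbert space `(ℂ^d)^{⊗ n}` of the chain, written in the computational basis. -/
abbrev ChainSpace (n d : ℕ) : Type := EuclideanSpace ℂ (SpinConfig n d)

/-- Operators on `(ℂ^d)^{⊗ n}`, as matrices in the computational basis. -/
abbrev ChainOperator (n d : ℕ) : Type := Matrix (SpinConfig n d) (SpinConfig n d) ℂ

/-- The coefficient matrix of `ψ` across the cut that separates the first `m` spins from the
remaining `n - m`: its rows are the configurations of the left part, its columns those of the
right part. -/
noncomputable def cutMatrix {n d : ℕ} (ψ : ChainSpace n d) (m : ℕ) :
    Matrix ({k : Fin n // (k : ℕ) < m} → Fin d) ({k : Fin n // ¬ (k : ℕ) < m} → Fin d) ℂ :=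
  Matrix.of fun a b => ψ fun k => if h : (k : ℕ) < m then a ⟨k, h⟩ else b ⟨k, h⟩

/-- The Schmidt coefficients of `ψ` across the cut after the first `m` spins, in nonascending
order, i.e. the singular values of the coefficient matrix. The sequence is indexed from `0`
(the largest coefficient is `schmidtCoeff ψ m 0`) and is padded with zeros. -/
noncomputable def schmidtCoeff {n d : ℕ} (ψ : ChainSpace n d) (m : ℕ) : ℕ →₀ ℝ :=
  (Matrix.toEuclideanLin (cutMatrix ψ m)).singularValues

/-- The Schmidt weight across the cut after the first `m` spins that lies beyond the `D` largest
Schmidt coefficients. -/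
noncomputable def schmidtTail {n d : ℕ} (ψ : ChainSpace n d) (m D : ℕ) : ℝ :=
  ∑ j ∈ (schmidtCoeff ψ m).support with D ≤ j, schmidtCoeff ψ m j ^ 2

/-- The truncation error `ε_D`: the maximum of the Schmidt weight tails over all cuts. The two
trivial cuts `m = 0` and `m = n` are included; they have Schmidt rank at most one and so
contribute `0` as soon as `1 ≤ D`. -/
noncomputable def truncationError {n d : ℕ} (ψ : ChainSpace n d) (D : ℕ) : ℝ :=
  Finset.univ.sup' Finset.univ_nonempty fun m : Fin (n + 1) => schmidtTail ψ m D

/-- A matrix product operator with open boundary conditions on a chain of `n` spins of local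
dimension `d`, with respect to the basis `|i⟩⟨j|` (indexed by the pairs `i`, `j`) of the operators
on each spin. -/
structure MatrixProductOperator (n d : ℕ) where
  dim : Fin (n + 1) → ℕ
  dim_pos : ∀ k, 0 < dim k
  dim_first : dim 0 = 1
  dim_last : dim (Fin.last n) = 1
  tensor : (k : Fin n) → Fin d → Fin d → Matrix (Fin (dim k.castSucc)) (Fin (dim k.succ)) ℂ

namespace MatrixProductOperator

variable {n d : ℕ}

/-- The bond dimension: the maximum of the sizes of the bonds. -/
def bondDim (M : MatrixProductOperator n d) : ℕ := Finset.univ.sup M.dim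

/-- The product of the first `k` matrices selected by the configurations `i` and `j`. -/
noncomputable def partialProd (M : MatrixProductOperator n d) (i j : SpinConfig n d)
    (k : Fin (n + 1)) : Matrix (Fin (M.dim 0)) (Fin (M.dim k)) ℂ :=
  Fin.induction (motive := fun k => Matrix (Fin (M.dim 0)) (Fin (M.dim k)) ℂ)
    1 (fun k P => P * M.tensor k (i k) (j k)) k

/-- The operator represented by the matrix product operator: the coefficient of
`|i_1 ⋯ i_n⟩⟨j_1 ⋯ j_n|` is the only entry of the `1 × 1` product of the selected matrices. -/
noncomputable def toOperator (M : MatrixProductOperator n d) : ChainOperator n d :=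
  Matrix.of fun i j => M.partialProd i j (Fin.last n) ⟨0, M.dim_pos _⟩ ⟨0, M.dim_pos _⟩

end MatrixProductOperator

/-- The operator `o ⊗ 1` that acts as `o` on the spins in `I` and trivially on the others. -/
def extendOperator {n d : ℕ} (I : Finset (Fin n)) (o : Matrix (I → Fin d) (I → Fin d) ℂ) :
    ChainOperator n d :=
  Matrix.of fun i j => if ∀ k, k ∉ I → i k = j k then o (fun k => i k) (fun k => j k) else 0

/-- `O` is `ℓ`-local: it acts nontrivially only on a block of `ℓ` consecutive spins. -/
def IsLocalOperator {n d : ℕ} (ℓ : ℕ) (O : ChainOperator n d) : Prop :=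
  ∃ (a : ℕ) (o : Matrix ((Finset.univ.filter fun k : Fin n => a ≤ (k : ℕ) ∧ (k : ℕ) < a + ℓ :
        Finset (Fin n)) → Fin d)
      ((Finset.univ.filter fun k : Fin n => a ≤ (k : ℕ) ∧ (k : ℕ) < a + ℓ :
        Finset (Fin n)) → Fin d) ℂ),
    O = extendOperator _ o

/-- The operator norm on `(ℂ^d)^{⊗ n}`. -/
noncomputable def operatorNorm {n d : ℕ} (O : ChainOperator n d) : ℝ :=
  ‖Matrix.toEuclideanCLM (n := SpinConfig n d) (𝕜 := ℂ) O‖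

/-- The expectation value `⟨ψ|O|ψ⟩`. -/
noncomputable def expectation {n d : ℕ} (ψ : ChainSpace n d) (O : ChainOperator n d) : ℂ :=
  inner ℂ ψ (Matrix.toEuclideanCLM (n := SpinConfig n d) (𝕜 := ℂ) O ψ)

/-!
The operator `ρ` is obtained from `|ψ⟩⟨ψ|` by applying one quantum channel per cut, from right to
left. Let `P` be the projection onto the `D` leading left Schmidt vectors at the cut after `m`
spins (a single one at the two trivial cuts), and write `p m = P ψ`. Applying only the projections
would let the truncation errors add up along the chain. Instead the channel at the cut `m` applies
`√s • P` with `s = ‖p (m + 1)‖²` and, when this fails, resets the first `m` spins to a mixed state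
supported in the range of `P` (`exists_truncation_channel`).

The reset state is chosen so that the channel takes the normalised `p (m + 1)` to the normalised
`p m`, as far as the first `m` spins are concerned (`exists_local_channel`). This is possible
because what the projection yields there is dominated by the reduced state of `p m`: a Schmidt
truncation and its remainder are not connected by operators to the left of the cut
(`exists_cut_truncation`). Hence the channels to the right of a window do not accumulate errors,
while those to the left of it are trace preserving and act on spins that are traced out. Only the
channels inside the window contribute, each by `O(√ε)`, since it is close to the identity on `ψ`
(`norm_expectation_sub_trace_schrodinger_le`). These estimates are made in the Heisenberg picture,
where only expectations in pure states occur.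

Every Kraus operator at the cut `m` has range in the range of `P`, so the result is a matrix
product operator whose bond at `m` carries pairs of indices of Schmidt vectors (`krausMPO`,
`toOperator_krausMPO`); it is positive semidefinite as the image of `|ψ⟩⟨ψ|` under channels.
-/

/-! ### Operators on a subset of the spins -/

section SiteOperators

variable {n d : ℕ}

/-- The configuration `i` with its values on the spins in `p` replaced by those of `b`. -/
def overwrite (p : Fin n → Prop) [DecidablePred p] (b : {k // p k} → Fin d)
    (i : SpinConfig n d) : SpinConfig n d :=
  fun k => if h : p k then b ⟨k, h⟩ else i k

/-- The operator `A ⊗ 1` acting as `A` on the spins in `p` and trivially on the others. It is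
`extendOperator` for a set of spins given by a predicate. -/
def siteOp (p : Fin n → Prop) [DecidablePred p]
    (A : Matrix ({k // p k} → Fin d) ({k // p k} → Fin d) ℂ) : ChainOperator n d :=
  Matrix.of fun i j => if ∀ k, ¬ p k → i k = j k then A (fun k => i k) (fun k => j k) else 0

theorem restrict_overwrite_of_disjoint (p q : Fin n → Prop) [DecidablePred q]
    (h : ∀ k, p k → ¬ q k) (b : {k // q k} → Fin d)
    (i : SpinConfig n d) :
    (fun k : {k // p k} => overwrite q b i k) = fun k : {k // p k} => i k := by
  funext k; simp [overwrite, h k k.2]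

variable (p q : Fin n → Prop) [DecidablePred p] [DecidablePred q]

theorem restrict_overwrite (b : {k // p k} → Fin d) (i : SpinConfig n d) :
    (fun k : {k // p k} => overwrite p b i k) = b := by
  funext k; simp [overwrite, k.2]

theorem overwrite_comm (h : ∀ k, p k → ¬ q k) (b : {k // p k} → Fin d) (c : {k // q k} → Fin d)
    (i : SpinConfig n d) :
    overwrite p b (overwrite q c i) = overwrite q c (overwrite p b i) := by
  funext k
  by_cases hp : p k
  · simp [overwrite, hp, h k hp]
  · simp [overwrite, hp]

theorem overwrite_overwrite_of_imp (h : ∀ k, p k → q k) (b : {k // p k} → Fin d)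
    (c : {k // q k} → Fin d) (i : SpinConfig n d) :
    overwrite q c (overwrite p b i) = overwrite q c i := by
  funext k
  by_cases hq : q k
  · simp [overwrite, hq]
  · simp [overwrite, hq, mt (h k) hq]

theorem overwrite_restrict (i j : SpinConfig n d) (h : ∀ k, ¬ p k → i k = j k) :
    overwrite p (fun k => j k) i = j := by
  funext k
  by_cases hp : p k
  · simp [overwrite, hp]
  · simp [overwrite, hp, h k hp]

variable {p q}

theorem siteOp_mulVec (A : Matrix ({k // p k} → Fin d) ({k // p k} → Fin d) ℂ)
    (x : SpinConfig n d → ℂ) (i : SpinConfig n d) :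
    (siteOp p A).mulVec x i = ∑ b, A (fun k => i k) b * x (overwrite p b i) := by
  simp only [Matrix.mulVec, dotProduct, siteOp, Matrix.of_apply, ite_mul, zero_mul]
  rw [← Finset.sum_filter]
  refine Finset.sum_nbij' (fun j => fun k => j k) (fun b => overwrite p b i) ?_ ?_ ?_ ?_ ?_
  · simp
  · intro b _
    simp +contextual [overwrite]
  · intro j hj
    exact overwrite_restrict p i j (by simpa using hj)
  · intro b _
    exact restrict_overwrite p b i
  · intro j hj
    rw [overwrite_restrict p i j (by simpa using hj)]

theorem siteOp_mul (A B : Matrix ({k // p k} → Fin d) ({k // p k} → Fin d) ℂ) :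
    siteOp p (A * B) = siteOp p A * siteOp p B := by
  refine Matrix.ext_iff_mulVec.2 fun x => ?_
  funext i
  rw [← Matrix.mulVec_mulVec, siteOp_mulVec, siteOp_mulVec]
  simp only [siteOp_mulVec, restrict_overwrite, overwrite_overwrite_of_imp p p (fun _ h => h),
    Matrix.mul_apply, Finset.sum_mul, Finset.mul_sum]
  rw [Finset.sum_comm]
  simp only [mul_assoc]

theorem siteOp_commute (h : ∀ k, p k → ¬ q k)
    (A : Matrix ({k // p k} → Fin d) ({k // p k} → Fin d) ℂ)
    (B : Matrix ({k // q k} → Fin d) ({k // q k} → Fin d) ℂ) :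
    siteOp p A * siteOp q B = siteOp q B * siteOp p A := by
  refine Matrix.ext_iff_mulVec.2 fun x => ?_
  funext i
  simp only [← Matrix.mulVec_mulVec, siteOp_mulVec, Finset.mul_sum]
  rw [Finset.sum_comm]
  refine Finset.sum_congr rfl fun c _ => Finset.sum_congr rfl fun b _ => ?_
  rw [restrict_overwrite_of_disjoint p q h, restrict_overwrite_of_disjoint q p
    (fun k hq hp => h k hp hq), overwrite_comm p q h]
  ring

theorem siteOp_one : siteOp p (1 : Matrix ({k // p k} → Fin d) ({k // p k} → Fin d) ℂ) = 1 := by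
  ext i j
  simp only [siteOp, Matrix.of_apply, Matrix.one_apply, funext_iff, Subtype.forall]
  by_cases h : ∀ k, i k = j k
  · simp [h]
  · have : ¬ ((∀ k, ¬ p k → i k = j k) ∧ ∀ k, p k → i k = j k) := fun h' =>
      h fun k => if hk : p k then h'.2 k hk else h'.1 k hk
    grind

theorem siteOp_conjTranspose (A : Matrix ({k // p k} → Fin d) ({k // p k} → Fin d) ℂ) :
    (siteOp p A).conjTranspose = siteOp p A.conjTranspose := by
  ext i j
  simp only [siteOp, Matrix.conjTranspose_apply, Matrix.of_apply, eq_comm (a := j _)]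
  split_ifs <;> simp

theorem siteOp_add (A B : Matrix ({k // p k} → Fin d) ({k // p k} → Fin d) ℂ) :
    siteOp p (A + B) = siteOp p A + siteOp p B := by
  ext i j
  simp only [siteOp, Matrix.of_apply, Matrix.add_apply]
  split_ifs <;> simp

theorem siteOp_sub (A B : Matrix ({k // p k} → Fin d) ({k // p k} → Fin d) ℂ) :
    siteOp p (A - B) = siteOp p A - siteOp p B := by
  ext i j
  simp only [siteOp, Matrix.of_apply, Matrix.sub_apply]
  split_ifs <;> simp

theorem siteOp_smul (c : ℂ) (A : Matrix ({k // p k} → Fin d) ({k // p k} → Fin d) ℂ) :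
    siteOp p (c • A) = c • siteOp p A := by
  ext i j
  simp only [siteOp, Matrix.of_apply, Matrix.smul_apply]
  split_ifs <;> simp

theorem siteOp_sum {ι : Type*} (s : Finset ι)
    (A : ι → Matrix ({k // p k} → Fin d) ({k // p k} → Fin d) ℂ) :
    siteOp p (∑ a ∈ s, A a) = ∑ a ∈ s, siteOp p (A a) := by
  ext i j
  simp only [siteOp, Matrix.of_apply, Matrix.sum_apply]
  split_ifs <;> simp

/-- An operator on the spins in `p` is also an operator on any larger set `q` of spins: tensor with
the identity on `q` minus `p`. -/
theorem exists_siteOp_of_imp (h : ∀ k, p k → q k)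
    (A : Matrix ({k // p k} → Fin d) ({k // p k} → Fin d) ℂ) :
    ∃ B : Matrix ({k // q k} → Fin d) ({k // q k} → Fin d) ℂ, siteOp p A = siteOp q B := by
  refine ⟨Matrix.of fun a b => if ∀ k : {k // q k}, ¬ p k → a k = b k then
    A (fun k => a ⟨k, h k k.2⟩) (fun k => b ⟨k, h k k.2⟩) else 0, ?_⟩
  ext i j
  simp only [siteOp, Matrix.of_apply, Subtype.forall]
  grind

theorem extendOperator_eq_siteOp (I : Finset (Fin n)) (o : Matrix (I → Fin d) (I → Fin d) ℂ) :
    extendOperator I o = siteOp (fun k => k ∈ I) o := rfl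

end SiteOperators

/-! ### Matrix elements and cuts of the chain -/

section MatrixElements

open Matrix

variable {n d : ℕ}

/-- Basis configurations of the first `m` spins of a chain of `n` spins. -/
abbrev LeftConfig (n d m : ℕ) : Type := {k : Fin n // (k : ℕ) < m} → Fin d

/-- Basis configurations of the spins of a chain of `n` spins that follow the first `m`. -/
abbrev RightConfig (n d m : ℕ) : Type := {k : Fin n // ¬ (k : ℕ) < m} → Fin d

/-- The operator `Z` applied to the state `x`. -/
noncomputable abbrev act (Z : ChainOperator n d) (x : ChainSpace n d) : ChainSpace n d :=
  Matrix.toEuclideanCLM (n := SpinConfig n d) (𝕜 := ℂ) Z x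

/-- The matrix element `⟨x|Z|y⟩`. -/
noncomputable def matElt (x : ChainSpace n d) (Z : ChainOperator n d) (y : ChainSpace n d) : ℂ :=
  inner ℂ x (act Z y)

theorem matElt_eq_sum (x : ChainSpace n d) (Z : ChainOperator n d) (y : ChainSpace n d) :
    matElt x Z y = ∑ i, ∑ j, star (x i) * Z i j * y j := by
  simp only [matElt, PiLp.inner_apply, act, ofLp_toEuclideanCLM, Matrix.mulVec, dotProduct,
    RCLike.inner_apply, Finset.sum_mul]
  exact Finset.sum_congr rfl fun i _ => Finset.sum_congr rfl fun j _ => by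
    rw [Complex.star_def]; ring

theorem act_mul (A B : ChainOperator n d) (x : ChainSpace n d) :
    act (A * B) x = act A (act B x) := by
  simp [act]

theorem act_one (x : ChainSpace n d) : act 1 x = x := by
  simp [act]

theorem inner_act_left (K : ChainOperator n d) (x y : ChainSpace n d) :
    inner ℂ (act K x) y = inner ℂ x (act Kᴴ y) := by
  have h : Matrix.toEuclideanCLM (n := SpinConfig n d) (𝕜 := ℂ) Kᴴ =
      ContinuousLinearMap.adjoint (Matrix.toEuclideanCLM (n := SpinConfig n d) (𝕜 := ℂ) K) := by
    rw [← Matrix.star_eq_conjTranspose, map_star, ContinuousLinearMap.star_eq_adjoint]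
  rw [act, act, h, ContinuousLinearMap.adjoint_inner_right]

theorem matElt_conj (K Z : ChainOperator n d) (x y : ChainSpace n d) :
    matElt x (Kᴴ * Z * K) y = matElt (act K x) Z (act K y) := by
  rw [matElt, matElt, inner_act_left, mul_assoc, act_mul, act_mul]

theorem matElt_one (x y : ChainSpace n d) : matElt x 1 y = inner ℂ x y := by
  rw [matElt, act_one]

theorem matElt_add (x y : ChainSpace n d) (A B : ChainOperator n d) :
    matElt x (A + B) y = matElt x A y + matElt x B y := by
  rw [matElt, act, map_add, _root_.add_apply, inner_add_right]; rfl

theorem matElt_sub (x y : ChainSpace n d) (A B : ChainOperator n d) :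
    matElt x (A - B) y = matElt x A y - matElt x B y := by
  rw [matElt, act, map_sub, _root_.sub_apply, inner_sub_right]; rfl

theorem matElt_smul (x y : ChainSpace n d) (c : ℂ) (A : ChainOperator n d) :
    matElt x (c • A) y = c * matElt x A y := by
  rw [matElt, act, map_smul, _root_.smul_apply, inner_smul_right]; rfl

theorem matElt_sum {ι : Type*} (s : Finset ι) (x y : ChainSpace n d) (A : ι → ChainOperator n d) :
    matElt x (∑ a ∈ s, A a) y = ∑ a ∈ s, matElt x (A a) y := by
  rw [matElt, act, map_sum, _root_.sum_apply, inner_sum]; rfl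

theorem norm_matElt_le (x y : ChainSpace n d) (Z : ChainOperator n d) :
    ‖matElt x Z y‖ ≤ operatorNorm Z * ‖x‖ * ‖y‖ := by
  refine (norm_inner_le_norm _ _).trans ?_
  rw [mul_comm, mul_right_comm]
  gcongr
  exact ContinuousLinearMap.le_opNorm _ _

/-- The operator `A ⊗ 1` acting as `A` on the first `m` spins. -/
abbrev leftOp (m : ℕ) (A : Matrix (LeftConfig n d m) (LeftConfig n d m) ℂ) : ChainOperator n d :=
  siteOp (fun k => (k : ℕ) < m) A

theorem leftOp_one (m : ℕ) : leftOp m 1 = (1 : ChainOperator n d) := siteOp_one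

theorem leftOp_mul (m : ℕ) (A B : Matrix (LeftConfig n d m) (LeftConfig n d m) ℂ) :
    leftOp m (A * B) = leftOp m A * leftOp m B := siteOp_mul A B

theorem leftOp_conjTranspose (m : ℕ) (A : Matrix (LeftConfig n d m) (LeftConfig n d m) ℂ) :
    (leftOp m A)ᴴ = leftOp m Aᴴ := siteOp_conjTranspose A

theorem leftOp_add (m : ℕ) (A B : Matrix (LeftConfig n d m) (LeftConfig n d m) ℂ) :
    leftOp m (A + B) = leftOp m A + leftOp m B := siteOp_add A B

theorem leftOp_sub (m : ℕ) (A B : Matrix (LeftConfig n d m) (LeftConfig n d m) ℂ) :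
    leftOp m (A - B) = leftOp m A - leftOp m B := siteOp_sub A B

theorem leftOp_smul (m : ℕ) (c : ℂ) (A : Matrix (LeftConfig n d m) (LeftConfig n d m) ℂ) :
    leftOp m (c • A) = c • leftOp m A := siteOp_smul c A

theorem leftOp_sum (m : ℕ) {ι : Type*} (s : Finset ι)
    (A : ι → Matrix (LeftConfig n d m) (LeftConfig n d m) ℂ) :
    leftOp m (∑ a ∈ s, A a) = ∑ a ∈ s, leftOp m (A a) := siteOp_sum s A

/-- Operators to the left of a cut act on the coefficient matrix by left multiplication. -/
theorem cutMatrix_act_leftOp (m : ℕ) (A : Matrix (LeftConfig n d m) (LeftConfig n d m) ℂ)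
    (x : ChainSpace n d) :
    cutMatrix (act (leftOp m A) x) m = A * cutMatrix x m := by
  ext a b
  simp only [cutMatrix, of_apply, Matrix.mul_apply, act, ofLp_toEuclideanCLM, siteOp_mulVec]
  refine Finset.sum_congr rfl fun c _ => ?_
  congr 1
  · congr 1
    funext k
    simp [k.2]
  · refine congrArg x.ofLp (funext fun k => ?_)
    by_cases hk : (k : ℕ) < m <;> simp [overwrite, hk]

theorem inner_eq_trace (m : ℕ) (x y : ChainSpace n d) :
    inner ℂ x y = ((cutMatrix x m)ᴴ * cutMatrix y m).trace := by
  simp only [PiLp.inner_apply, RCLike.inner_apply, Matrix.trace, Matrix.diag, Matrix.mul_apply,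
    conjTranspose_apply]
  rw [Finset.sum_comm, ← Fintype.sum_prod_type' (f := fun a b =>
    star (cutMatrix x m a b) * cutMatrix y m a b)]
  refine Fintype.sum_equiv (Equiv.piEquivPiSubtypeProd (fun k : Fin n => (k : ℕ) < m)
    (fun _ => Fin d)) _ _ fun i => ?_
  simp only [cutMatrix, of_apply, Equiv.piEquivPiSubtypeProd, Equiv.coe_fn_mk, dite_eq_ite,
    ite_self]
  rw [mul_comm]
  rfl

theorem matElt_leftOp (m : ℕ) (A : Matrix (LeftConfig n d m) (LeftConfig n d m) ℂ)
    (x y : ChainSpace n d) :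
    matElt x (leftOp m A) y = ((cutMatrix x m)ᴴ * A * cutMatrix y m).trace := by
  rw [matElt, inner_eq_trace m, cutMatrix_act_leftOp, Matrix.mul_assoc]

theorem cutMatrix_sub (m : ℕ) (x y : ChainSpace n d) :
    cutMatrix (x - y) m = cutMatrix x m - cutMatrix y m := by
  ext a b; simp [cutMatrix]

theorem cutMatrix_injective (m : ℕ) :
    Function.Injective fun x : ChainSpace n d => cutMatrix x m := by
  intro x y h
  have h0 : inner ℂ (x - y) (x - y) = (0 : ℂ) := by
    rw [inner_eq_trace m, cutMatrix_sub, show cutMatrix x m = cutMatrix y m from h]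
    simp
  exact sub_eq_zero.1 (inner_self_eq_zero.1 h0)

end MatrixElements

/-! ### Truncated Schmidt decomposition -/

section Schmidt

open Matrix

variable {L R : Type*} [Fintype L] [Fintype R] [DecidableEq R]

/-- The right singular vectors of `M`, as the columns of a unitary `V`, in the order of
`LinearMap.singularValues`; the columns of `M * V` are then orthogonal. -/
theorem exists_singular_basis (M : Matrix L R ℂ) {N : ℕ} (hN : Fintype.card R = N) :
    ∃ V : Matrix R (Fin N) ℂ, Vᴴ * V = 1 ∧ V * Vᴴ = 1 ∧
      (M * V)ᴴ * (M * V) =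
        diagonal fun j : Fin N => (((toEuclideanLin M).singularValues j : ℝ) : ℂ) ^ 2 := by
  set T := toEuclideanLin M with hT
  have hn : Module.finrank ℂ (EuclideanSpace ℂ R) = N :=
    finrank_euclideanSpace.trans hN
  set e := T.isSymmetric_adjoint_comp_self.eigenvectorBasis hn with he
  set V : Matrix R (Fin N) ℂ := of fun b j => e j b with hV
  have h1 : Vᴴ * V = 1 := by
    ext j k
    have := orthonormal_iff_ite.1 e.orthonormal j k
    rw [PiLp.inner_apply] at this
    rw [Matrix.one_apply, ← this, Matrix.mul_apply]
    exact Finset.sum_congr rfl fun b _ => by simp [hV, mul_comm]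
  refine ⟨V, h1, (Matrix.mul_eq_one_comm_of_card_eq _ _ _ (by simp [hN])).1 h1, ?_⟩
  ext j k
  have h2 : ∀ k a, (M * V) a k = T (e k) a := fun k a => by
    simp [hT, hV, Matrix.mul_apply, Matrix.mulVec, dotProduct]
  have h3 : ((M * V)ᴴ * (M * V)) j k = inner ℂ (T (e j)) (T (e k)) := by
    rw [PiLp.inner_apply, Matrix.mul_apply]
    exact Finset.sum_congr rfl fun b _ => by
      rw [conjTranspose_apply, h2, h2, RCLike.inner_apply, mul_comm]; rfl
  rw [h3, ← LinearMap.adjoint_inner_right, ← LinearMap.comp_apply,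
    T.isSymmetric_adjoint_comp_self.apply_eigenvectorBasis hn k, inner_smul_right,
    orthonormal_iff_ite.1 e.orthonormal j k, diagonal_apply]
  split_ifs with h
  · subst h
    rw [← T.sq_singularValues_fin hn j]
    push_cast
    simp
  · simp

/-- The columns of `W` are the first `r` left singular vectors of `M`, with zero columns in place of
those of singular value `0`, so `W * Wᴴ` is an orthogonal projection. Truncating with it leaves
rows orthogonal to those of the remainder, because it commutes with `M * Mᴴ`. -/
theorem exists_schmidt_truncation (M : Matrix L R ℂ) (r : ℕ) :
    ∃ W : Matrix L (Fin r) ℂ, W * Wᴴ * W = W ∧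
      (W * Wᴴ * M) * (M - W * Wᴴ * M)ᴴ = 0 ∧
      ((M - W * Wᴴ * M)ᴴ * (M - W * Wᴴ * M)).trace =
        ((∑ j ∈ (toEuclideanLin M).singularValues.support with r ≤ j,
          (toEuclideanLin M).singularValues j ^ 2 : ℝ) : ℂ) ∧
      (1 ≤ r → W * Wᴴ * M = 0 → M = 0) := by
  obtain ⟨N, hN⟩ : ∃ N, Fintype.card R = N := ⟨_, rfl⟩
  obtain ⟨V, hV1, hV2, hY⟩ := exists_singular_basis M hN
  set σ := (toEuclideanLin M).singularValues
  set Y := M * V with hYdef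
  have hYcol : ∀ k : Fin N, σ k = 0 → ∀ a, Y a k = 0 := by
    intro k hk
    have h := congrFun (congrFun hY k) k
    rw [Matrix.mul_apply, diagonal_apply_eq, hk] at h
    have h' : ∑ a, ‖Y a k‖ ^ 2 = (0 : ℝ) := by
      have : ∑ a, ((‖Y a k‖ ^ 2 : ℝ) : ℂ) = 0 := by
        rw [← Complex.ofReal_zero] at *
        convert h using 1
        · refine Finset.sum_congr rfl fun a _ => ?_
          rw [conjTranspose_apply, Complex.ofReal_pow, ← Complex.conj_mul']
          rfl
        · simp
      exact_mod_cast this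
    intro a
    have := (Finset.sum_eq_zero_iff_of_nonneg (fun a _ => sq_nonneg ‖Y a k‖)).1 h' a
      (Finset.mem_univ a)
    simpa using this
  -- For a singular value `0` the division returns `0`, which is the intended zero column.
  set W : Matrix L (Fin r) ℂ := of fun a j => if h : (j : ℕ) < N then Y a ⟨j, h⟩ / σ j else 0
    with hW
  have hYY : ∀ j k : Fin N, ∑ a, star (Y a j) * Y a k = if j = k then (σ j : ℂ) ^ 2 else 0 :=
    fun j k => by
      have h := congrFun (congrFun hY j) k
      rw [Matrix.mul_apply, diagonal_apply] at h
      exact h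
  have hWY : Wᴴ * Y = of fun (j : Fin r) (k : Fin N) => if (j : ℕ) = k then (σ j : ℂ) else 0 := by
    ext j k
    rw [Matrix.mul_apply]
    by_cases hj : (j : ℕ) < N
    · have h1 : ∀ a, Wᴴ j a * Y a k = (σ j : ℂ)⁻¹ * (star (Y a ⟨j, hj⟩) * Y a k) := fun a => by
        simp only [hW, conjTranspose_apply, of_apply, dif_pos hj, star_div₀, Complex.star_def,
          Complex.conj_ofReal]
        ring
      simp only [h1, ← Finset.mul_sum, hYY, of_apply, Fin.ext_iff]
      split_ifs
      · by_cases h0 : (σ j : ℂ) = 0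
        · simp [h0]
        · field_simp
      · simp
    · have h2 : (j : ℕ) ≠ k := fun h => hj (h ▸ k.2)
      simp [hW, hj, h2]
  set Q : Matrix (Fin N) (Fin N) ℂ := diagonal fun k => if (k : ℕ) < r then 1 else 0 with hQ
  have hPY : W * Wᴴ * Y = Y * Q := by
    ext a k
    rw [Matrix.mul_assoc, hWY, Matrix.mul_apply, hQ, mul_diagonal]
    simp only [hW, of_apply]
    by_cases hk : (k : ℕ) < r
    · rw [Finset.sum_eq_single (⟨k, hk⟩ : Fin r)]
      · simp only [k.2, dif_pos, if_true, hk, mul_one]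
        by_cases h0 : σ k = 0
        · simp [h0, hYcol k h0]
        · have : (σ k : ℂ) ≠ 0 := by exact_mod_cast h0
          field_simp
      · intro j _ hj
        have : (j : ℕ) ≠ k := fun h => hj (Fin.ext h)
        simp [this]
      · simp
    · rw [if_neg hk, mul_zero]
      refine Finset.sum_eq_zero fun j _ => ?_
      have : (j : ℕ) ≠ k := fun h => hk (h ▸ j.2)
      simp [this]
  -- In terms of `M = Y * Vᴴ`, the projection `W * Wᴴ` keeps the first `r` columns of `Y`.
  have hM : M = Y * Vᴴ := by rw [hYdef, Matrix.mul_assoc, hV2, Matrix.mul_one]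
  have hPM : W * Wᴴ * M = Y * Q * Vᴴ := by
    conv_lhs => rw [hM]
    rw [← Matrix.mul_assoc, hPY]
  have hMPM : M - W * Wᴴ * M = Y * (1 - Q) * Vᴴ := by
    rw [hPM, Matrix.mul_sub, Matrix.sub_mul, Matrix.mul_one, ← hM]
  have hQh : Qᴴ = Q := by
    rw [hQ, diagonal_conjTranspose]
    congr 1
    funext k
    simp only [Pi.star_apply]
    split_ifs <;> simp
  have hQQ : Q * Q = Q := by
    rw [hQ, diagonal_mul_diagonal]
    simp
  have hWYW : ∀ j : Fin r, ∀ a, (W * Wᴴ * W) a j = W a j := by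
    intro j a
    by_cases hj : (j : ℕ) < N
    · have h1 : ∀ b, W b j = Y b ⟨j, hj⟩ * (σ j : ℂ)⁻¹ := fun b => by
        simp [hW, hj, div_eq_mul_inv]
      have h2 := congrFun (congrFun hPY a) ⟨j, hj⟩
      rw [hQ, mul_diagonal, if_pos j.2, mul_one, Matrix.mul_apply] at h2
      rw [Matrix.mul_apply, h1, ← h2, Finset.sum_mul]
      simp only [h1, mul_assoc]
    · have h1 : ∀ b, W b j = 0 := fun b => by simp [hW, hj]
      simp [Matrix.mul_apply, h1]
  refine ⟨W, by ext a j; exact hWYW j a, ?_, ?_, ?_⟩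
  · rw [hMPM, hPM, conjTranspose_mul, conjTranspose_mul, conjTranspose_conjTranspose,
      conjTranspose_sub, hQh, conjTranspose_one]
    calc Y * Q * Vᴴ * (V * ((1 - Q) * Yᴴ)) = Y * (Q * (Vᴴ * V) * (1 - Q)) * Yᴴ := by
          simp only [Matrix.mul_assoc]
      _ = 0 := by rw [hV1, Matrix.mul_one, Matrix.mul_sub, hQQ]; simp
  · rw [hMPM, Matrix.trace_mul_comm, conjTranspose_mul, conjTranspose_mul,
      conjTranspose_conjTranspose, conjTranspose_sub, hQh, conjTranspose_one]
    have : Y * (1 - Q) * Vᴴ * (V * ((1 - Q) * Yᴴ)) = Y * (1 - Q) * Yᴴ := by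
      calc Y * (1 - Q) * Vᴴ * (V * ((1 - Q) * Yᴴ)) =
            Y * ((1 - Q) * (Vᴴ * V) * (1 - Q)) * Yᴴ := by simp only [Matrix.mul_assoc]
        _ = _ := by
          rw [hV1, Matrix.mul_one, Matrix.mul_sub, Matrix.mul_one, Matrix.sub_mul, hQQ]; simp
    rw [this, Matrix.trace_mul_comm, ← Matrix.mul_assoc, hY, hQ, ← diagonal_one, diagonal_sub,
      diagonal_mul_diagonal, trace_diagonal]
    have h1 : ∀ k : Fin N, ((σ k : ℝ) : ℂ) ^ 2 * (1 - if (k : ℕ) < r then 1 else 0) =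
        ((if r ≤ (k : ℕ) then σ k ^ 2 else 0 : ℝ) : ℂ) := fun k => by
      by_cases hk : (k : ℕ) < r
      · rw [if_pos hk, if_neg (not_le.2 hk)]; simp
      · simp [hk, not_lt.1 hk]
    simp only [h1]
    rw [← Complex.ofReal_sum, Finset.sum_filter, Fin.sum_univ_eq_sum_range
      (fun k => if r ≤ k then σ k ^ 2 else 0)]
    congr 1
    symm
    refine Finset.sum_subset ?_ ?_
    · intro j hj
      rw [Finset.mem_range]
      by_contra h
      refine Finsupp.mem_support_iff.1 hj ((toEuclideanLin M).singularValues_of_finrank_le ?_)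
      rw [finrank_euclideanSpace, hN]
      exact not_lt.1 h
    · intro j _ hj
      rw [Finsupp.notMem_support_iff] at hj
      simp [hj]
  · intro hr h0
    by_contra hM0
    have h1 : 0 < σ 0 := by
      rw [LinearMap.singularValues_pos_iff_lt_finrank_range, Nat.pos_iff_ne_zero, Ne,
        Submodule.finrank_eq_zero, LinearMap.range_eq_bot]
      simpa using hM0
    have hN0 : 0 < N := by
      by_contra h
      refine h1.ne' ((toEuclideanLin M).singularValues_of_finrank_le ?_)
      rw [finrank_euclideanSpace, hN]
      omega
    have h2 : Y * Q = 0 := by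
      have := congrArg (· * V) (hPM.symm.trans h0)
      rwa [Matrix.mul_assoc, hV1, Matrix.mul_one, Matrix.zero_mul] at this
    have h3 : ∀ a, Y a ⟨0, hN0⟩ = 0 := fun a => by
      have := congrFun (congrFun h2 a) ⟨0, hN0⟩
      rw [hQ, mul_diagonal] at this
      simpa [show 0 < r from hr] using this
    have h4 := hYY ⟨0, hN0⟩ ⟨0, hN0⟩
    simp [h3] at h4
    exact h1.ne' (by simpa using h4.symm)

end Schmidt

/-! ### Truncating a state at a cut -/

section Truncation

open Matrix

variable {n d : ℕ}

/-- Schmidt truncation of a state at one cut. The truncated state and the remainder have orthogonal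
supports to the right of the cut, so no operator to the left of it connects them. -/
theorem exists_cut_truncation (ψ : ChainSpace n d) (hψ : ψ ≠ 0) (m : ℕ) {r : ℕ} (hr : 1 ≤ r) :
    ∃ W : Matrix (LeftConfig n d m) (Fin r) ℂ, W * Wᴴ * W = W ∧
      (∀ A, matElt (act (leftOp m (W * Wᴴ)) ψ) (leftOp m A)
        (ψ - act (leftOp m (W * Wᴴ)) ψ) = 0) ∧
      ‖ψ - act (leftOp m (W * Wᴴ)) ψ‖ ^ 2 = schmidtTail ψ m r ∧
      act (leftOp m (W * Wᴴ)) ψ ≠ 0 := by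
  obtain ⟨W, h1, h2, h3, h4⟩ := exists_schmidt_truncation (cutMatrix ψ m) r
  refine ⟨W, h1, fun A => ?_, ?_, fun h => hψ ?_⟩
  · have h5 := congrArg conjTranspose h2
    rw [conjTranspose_mul, conjTranspose_conjTranspose, conjTranspose_zero] at h5
    rw [matElt_leftOp, cutMatrix_sub, cutMatrix_act_leftOp, Matrix.mul_assoc,
      Matrix.trace_mul_comm, Matrix.mul_assoc, h5, Matrix.mul_zero, Matrix.trace_zero]
  · have h5 := inner_eq_trace m (ψ - act (leftOp m (W * Wᴴ)) ψ) (ψ - act (leftOp m (W * Wᴴ)) ψ)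
    rw [cutMatrix_sub, cutMatrix_act_leftOp, h3, inner_self_eq_norm_sq_to_K] at h5
    apply Complex.ofReal_injective
    rw [schmidtTail, schmidtCoeff, ← h5]
    push_cast
    rfl
  · apply cutMatrix_injective m
    have h5 : W * Wᴴ * cutMatrix ψ m = 0 := by
      rw [← cutMatrix_act_leftOp, h]
      ext a b; simp [cutMatrix]
    simp only [h4 hr h5]
    ext a b; simp [cutMatrix]

theorem schmidtTail_nonneg (ψ : ChainSpace n d) (m D : ℕ) : 0 ≤ schmidtTail ψ m D :=
  Finset.sum_nonneg fun _ _ => sq_nonneg _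

theorem schmidtTail_le_truncationError (ψ : ChainSpace n d) {m : ℕ} (hm : m ≤ n) (D : ℕ) :
    schmidtTail ψ m D ≤ truncationError ψ D :=
  Finset.le_sup' (fun m : Fin (n + 1) => schmidtTail ψ m D)
    (Finset.mem_univ (⟨m, Nat.lt_succ_of_le hm⟩ : Fin (n + 1)))

theorem truncationError_nonneg (ψ : ChainSpace n d) (D : ℕ) : 0 ≤ truncationError ψ D :=
  (schmidtTail_nonneg ψ 0 D).trans (schmidtTail_le_truncationError ψ n.zero_le D)

theorem schmidtTail_one_of_trivial_cut (ψ : ChainSpace n d) {m : ℕ} (hm : m = 0 ∨ m = n) :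
    schmidtTail ψ m 1 = 0 := by
  have hrank : Module.finrank ℂ (toEuclideanLin (cutMatrix ψ m)).range ≤ 1 := by
    rcases hm with rfl | rfl
    · refine (Submodule.finrank_le _).trans ?_
      rw [finrank_euclideanSpace]
      have : IsEmpty {k : Fin n // (k : ℕ) < 0} := ⟨fun k => absurd k.2 (Nat.not_lt_zero _)⟩
      simp
    · refine (LinearMap.finrank_range_le _).trans ?_
      rw [finrank_euclideanSpace]
      have : IsEmpty {k : Fin m // ¬ (k : ℕ) < m} := ⟨fun k => k.2 k.1.2⟩
      simp
  refine Finset.sum_eq_zero fun j hj => absurd (Finset.mem_filter.1 hj) ?_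
  rw [schmidtCoeff, LinearMap.support_singularValues, Finset.mem_range]
  omega

/-- The number of Schmidt vectors kept across the cut after the first `m` spins: one at the two
trivial cuts, where the Schmidt rank is at most one, and `D` at all others. -/
def keptRank (n D m : ℕ) : ℕ := if m = 0 ∨ m = n then 1 else D

theorem one_le_keptRank {D : ℕ} (hD : 1 ≤ D) (m : ℕ) : 1 ≤ keptRank n D m := by
  unfold keptRank; split_ifs <;> omega

theorem schmidtTail_keptRank_le (ψ : ChainSpace n d) {m : ℕ} (hm : m ≤ n) (D : ℕ) :
    schmidtTail ψ m (keptRank n D m) ≤ truncationError ψ D := by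
  unfold keptRank
  split_ifs with h
  · rw [schmidtTail_one_of_trivial_cut ψ h]
    exact truncationError_nonneg ψ D
  · exact schmidtTail_le_truncationError ψ hm D

end Truncation

/-! ### The truncate-and-reset channel -/

section Channels

open Matrix

/-- Kraus operators of the map `X ↦ tr (Bᴴ B X) • g gᴴ`, stated for its dual. -/
theorem exists_reset_kraus {L ι : Type*} [Fintype L] [DecidableEq L] [Fintype ι] [DecidableEq ι]
    (g : Matrix L ι ℂ) (B : Matrix L L ℂ) :
    ∃ κ : ι × L → Matrix L L ℂ, (∀ a, ∃ X : Matrix ι L ℂ, κ a = g * X) ∧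
      ∀ A : Matrix L L ℂ, ∑ a, (κ a)ᴴ * A * κ a = (gᴴ * A * g).trace • (Bᴴ * B) := by
  refine ⟨fun a => g * (single a.1 a.2 (1 : ℂ) * B), fun a => ⟨_, rfl⟩, fun A => ?_⟩
  have h : ∀ a : ι × L,
      (g * (single a.1 a.2 (1 : ℂ) * B))ᴴ * A * (g * (single a.1 a.2 (1 : ℂ) * B)) =
      (gᴴ * A * g) a.1 a.1 • (Bᴴ * single a.2 a.2 (1 : ℂ) * B) := fun a => by
    have h1 : (g * (single a.1 a.2 (1 : ℂ) * B))ᴴ * A * (g * (single a.1 a.2 (1 : ℂ) * B)) =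
        Bᴴ * (single a.2 a.1 (1 : ℂ) * (gᴴ * A * g) * single a.1 a.2 (1 : ℂ)) * B := by
      rw [conjTranspose_mul, conjTranspose_mul, conjTranspose_single, star_one]
      simp only [Matrix.mul_assoc]
    have h2 : ∀ c : ℂ, single a.2 a.2 c = c • single a.2 a.2 (1 : ℂ) := fun c => by
      rw [smul_single, smul_eq_mul, mul_one]
    rw [h1, single_mul_mul_single, one_mul, mul_one, h2, Matrix.mul_smul, Matrix.smul_mul]
  simp only [h, Fintype.sum_prod_type, ← Finset.smul_sum, ← Finset.sum_smul, ← Matrix.sum_mul,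
    ← Matrix.mul_sum]
  rw [show ∑ l : L, single l l (1 : ℂ) = 1 from ?_, Matrix.mul_one]
  · rfl
  · exact Matrix.sum_single_one

variable {n d : ℕ}

theorem exists_conjTranspose_mul_self_eq_one_sub_smul {L : Type*} [Fintype L] [DecidableEq L]
    {P : Matrix L L ℂ} (hP : Pᴴ = P) (hPP : P * P = P) {s : ℝ} (hs : s ≤ 1) :
    ∃ B : Matrix L L ℂ, Bᴴ * B = 1 - (s : ℂ) • P := by
  refine ⟨(1 - P) + ((√(1 - s) : ℝ) : ℂ) • P, ?_⟩
  have h : ((√(1 - s) : ℝ) : ℂ) * ((√(1 - s) : ℝ) : ℂ) = 1 - s := by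
    rw [← Complex.ofReal_mul, Real.mul_self_sqrt (sub_nonneg.2 hs)]
    simp
  set c := ((√(1 - s) : ℝ) : ℂ) with hc
  rw [conjTranspose_add, conjTranspose_sub, conjTranspose_one, conjTranspose_smul, hP,
    Complex.star_def, hc, Complex.conj_ofReal, ← hc]
  calc (1 - P + c • P) * (1 - P + c • P) = 1 - P + (c * c) • P := by
        simp only [Matrix.add_mul, Matrix.mul_add, Matrix.sub_mul, Matrix.mul_sub,
          Matrix.smul_mul, Matrix.mul_smul, hPP, Matrix.one_mul, Matrix.mul_one]
        simp [mul_smul]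
    _ = 1 - (s : ℂ) • P := by rw [h, sub_smul, one_smul]; abel

/-- Kraus operators, with range in the projection `P`, of the channel that applies `√s • P` and
resets the first `m` spins to a fixed mixed state when this fails. The functional `γ` is the
expectation in that mixed state, taken proportional to the sum of the reduced states of `w₁`
and `w₂`; if both vanish, the last identity is void and the reduced state of `u` serves. -/
theorem exists_truncation_channel (m : ℕ)
    {P : Matrix (LeftConfig n d m) (LeftConfig n d m) ℂ}
    (hP : Pᴴ = P) (hPP : P * P = P) {s : ℝ} (hs0 : 0 ≤ s) (hs1 : s ≤ 1)
    {u w₁ w₂ : ChainSpace n d} (hu0 : u ≠ 0) (hu : act (leftOp m P) u = u)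
    (hw₁ : act (leftOp m P) w₁ = w₁) (hw₂ : act (leftOp m P) w₂ = w₂) :
    ∃ (N : ℕ) (κ : Option (Fin N) →
        Matrix (LeftConfig n d m) (LeftConfig n d m) ℂ)
      (γ : Matrix (LeftConfig n d m) (LeftConfig n d m) ℂ → ℂ),
      (∀ a, P * κ a = κ a) ∧ κ none = ((√s : ℝ) : ℂ) • P ∧ γ 1 = 1 ∧
      (∀ A, ∑ a, (κ a)ᴴ * A * κ a = (s : ℂ) • (P * A * P) + γ A • (1 - (s : ℂ) • P)) ∧
      ∀ A, ((‖w₁‖ ^ 2 + ‖w₂‖ ^ 2 : ℝ) : ℂ) * γ A =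
        matElt w₁ (leftOp m A) w₁ + matElt w₂ (leftOp m A) w₂ := by
  have hpair : ∀ v₁ v₂ : ChainSpace n d, ∀ A,
      ((fromCols (cutMatrix v₁ m) (cutMatrix v₂ m))ᴴ * A *
        fromCols (cutMatrix v₁ m) (cutMatrix v₂ m)).trace =
      matElt v₁ (leftOp m A) v₁ + matElt v₂ (leftOp m A) v₂ := fun v₁ v₂ A => by
    rw [matElt_leftOp, matElt_leftOp, Matrix.trace, Fintype.sum_sum_type]
    rfl
  have hrange : ∀ v₁ v₂ : ChainSpace n d, act (leftOp m P) v₁ = v₁ → act (leftOp m P) v₂ = v₂ →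
      P * fromCols (cutMatrix v₁ m) (cutMatrix v₂ m) =
        fromCols (cutMatrix v₁ m) (cutMatrix v₂ m) := fun v₁ v₂ h₁ h₂ => by
    rw [mul_fromCols, ← cutMatrix_act_leftOp, ← cutMatrix_act_leftOp, h₁, h₂]
  have hone : ∀ v : ChainSpace n d, matElt v (leftOp m 1) v = ((‖v‖ ^ 2 : ℝ) : ℂ) := fun v => by
    rw [leftOp_one, matElt_one, inner_self_eq_norm_sq_to_K]
    simp
  set c := ‖w₁‖ ^ 2 + ‖w₂‖ ^ 2 with hc
  -- The mixed state is `g * gᴴ`.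
  obtain ⟨g, hPg, hg1, hgc⟩ : ∃ g : Matrix (LeftConfig n d m)
      ((RightConfig n d m) ⊕ (RightConfig n d m)) ℂ,
      P * g = g ∧ (gᴴ * (1 : Matrix (LeftConfig n d m) (LeftConfig n d m) ℂ) * g).trace = 1 ∧
      ∀ A, (c : ℂ) * (gᴴ * A * g).trace =
        matElt w₁ (leftOp m A) w₁ + matElt w₂ (leftOp m A) w₂ := by
    have key : ∀ v₁ v₂ : ChainSpace n d, act (leftOp m P) v₁ = v₁ → act (leftOp m P) v₂ = v₂ →
        0 < ‖v₁‖ ^ 2 + ‖v₂‖ ^ 2 → ∃ g : Matrix (LeftConfig n d m)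
      ((RightConfig n d m) ⊕ (RightConfig n d m)) ℂ,
      P * g = g ∧ (gᴴ * (1 : Matrix (LeftConfig n d m) (LeftConfig n d m) ℂ) * g).trace = 1 ∧ ∀ A,
        ((‖v₁‖ ^ 2 + ‖v₂‖ ^ 2 : ℝ) : ℂ) * (gᴴ * A * g).trace =
        matElt v₁ (leftOp m A) v₁ + matElt v₂ (leftOp m A) v₂ := by
      intro v₁ v₂ h₁ h₂ hpos
      set e := ‖v₁‖ ^ 2 + ‖v₂‖ ^ 2 with he
      have hee : (((√e)⁻¹ : ℝ) : ℂ) * (((√e)⁻¹ : ℝ) : ℂ) = (e : ℂ)⁻¹ := by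
        rw [← Complex.ofReal_mul, ← mul_inv, Real.mul_self_sqrt hpos.le, Complex.ofReal_inv]
      have he0 : (e : ℂ) ≠ 0 := by exact_mod_cast hpos.ne'
      have htr : ∀ A, (((((√e)⁻¹ : ℝ) : ℂ) • fromCols (cutMatrix v₁ m) (cutMatrix v₂ m))ᴴ * A *
          ((((√e)⁻¹ : ℝ) : ℂ) • fromCols (cutMatrix v₁ m) (cutMatrix v₂ m))).trace =
          (e : ℂ)⁻¹ * (matElt v₁ (leftOp m A) v₁ + matElt v₂ (leftOp m A) v₂) := fun A => by
        rw [conjTranspose_smul, Matrix.smul_mul, Matrix.smul_mul, Matrix.mul_smul, trace_smul,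
          trace_smul, hpair, smul_eq_mul, smul_eq_mul, ← mul_assoc, Complex.star_def,
          Complex.conj_ofReal, hee]
      refine ⟨(((√e)⁻¹ : ℝ) : ℂ) • fromCols (cutMatrix v₁ m) (cutMatrix v₂ m), ?_, ?_, ?_⟩
      · rw [Matrix.mul_smul, hrange v₁ v₂ h₁ h₂]
      · rw [htr, hone, hone, ← Complex.ofReal_add, inv_mul_cancel₀ he0]
      · intro A
        rw [htr, mul_inv_cancel_left₀ he0]
    by_cases h0 : c = 0
    · have hz₁ : w₁ = 0 := by
        have : ‖w₁‖ ^ 2 = 0 := by nlinarith [sq_nonneg ‖w₁‖, sq_nonneg ‖w₂‖]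
        simpa using this
      have hz₂ : w₂ = 0 := by
        have : ‖w₂‖ ^ 2 = 0 := by nlinarith [sq_nonneg ‖w₁‖, sq_nonneg ‖w₂‖]
        simpa using this
      obtain ⟨g, h1, h2, -⟩ := key u 0 hu (by simp)
        (by have := norm_pos_iff.2 hu0; positivity)
      exact ⟨g, h1, h2, fun A => by simp [h0, hz₁, hz₂, matElt]⟩
    · exact key w₁ w₂ hw₁ hw₂ (lt_of_le_of_ne (by positivity) (Ne.symm h0))
  obtain ⟨B, hB⟩ := exists_conjTranspose_mul_self_eq_one_sub_smul hP hPP hs1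
  obtain ⟨κ, hκ1, hκ2⟩ := exists_reset_kraus g B
  let e := Fintype.equivFin
    (((RightConfig n d m) ⊕ (RightConfig n d m)) ×
      (LeftConfig n d m))
  refine ⟨_, fun a => a.elim (((√s : ℝ) : ℂ) • P) (fun j => κ (e.symm j)),
    fun A => (gᴴ * A * g).trace, ?_, rfl, hg1, fun A => ?_, hgc⟩
  · rintro (_ | j)
    · simp [hPP]
    · obtain ⟨X, hX⟩ := hκ1 (e.symm j)
      simp only [Option.elim_some]
      rw [hX, ← Matrix.mul_assoc, hPg]
  · rw [Fintype.sum_option, ← hB, ← hκ2]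
    congr 1
    · simp only [Option.elim_none]
      rw [conjTranspose_smul, hP, Matrix.smul_mul, Matrix.smul_mul, Matrix.mul_smul, smul_smul,
        Complex.star_def, Complex.conj_ofReal, ← Complex.ofReal_mul, Real.mul_self_sqrt hs0]
    · exact Equiv.sum_comp e.symm fun a => (κ a)ᴴ * A * κ a

end Channels

/-! ### Sequences of channels in the two pictures -/

section Evolution

open Matrix

variable {n d : ℕ} {ι : ℕ → Type} [∀ m, Fintype (ι m)]

/-- The completely positive map with Kraus operators `K`, in the Heisenberg picture. -/
def dualChannel {ι : Type} [Fintype ι] (K : ι → ChainOperator n d) (Z : ChainOperator n d) :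
    ChainOperator n d :=
  ∑ a, (K a)ᴴ * Z * K a

/-- The observable `Z` pulled back through the channels `K (m - 1), …, K 0`, of which `K (m - 1)` is
the first to act on the state. -/
def heisenberg (K : ∀ m, ι m → ChainOperator n d) : ℕ → ChainOperator n d → ChainOperator n d
  | 0, Z => Z
  | m + 1, Z => dualChannel (K m) (heisenberg K m Z)

/-- The image of `|x⟩⟨y|` under the channels `K (m - 1), …, K 0`, applied in this order. Two vectors
are carried along, instead of an operator, so that matrix product formulas can be read off. -/
noncomputable def schrodinger (K : ∀ m, ι m → ChainOperator n d) :
    ℕ → ChainSpace n d → ChainSpace n d → ChainOperator n d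
  | 0, x, y => Matrix.of fun i j => x i * star (y j)
  | m + 1, x, y => ∑ a, schrodinger K m (act (K m a) x) (act (K m a) y)

theorem matElt_dualChannel {ι : Type} [Fintype ι] (K : ι → ChainOperator n d)
    (Z : ChainOperator n d) (x y : ChainSpace n d) :
    matElt x (dualChannel K Z) y = ∑ a, matElt (act (K a) x) Z (act (K a) y) := by
  simp only [dualChannel, matElt_sum, matElt_conj]

theorem trace_schrodinger_mul (K : ∀ m, ι m → ChainOperator n d) (Z : ChainOperator n d) (m : ℕ)
    (x y : ChainSpace n d) :
    (schrodinger K m x y * Z).trace = matElt y (heisenberg K m Z) x := by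
  induction m generalizing x y with
  | zero =>
    simp only [schrodinger, heisenberg, matElt_eq_sum, Matrix.trace, Matrix.diag, Matrix.mul_apply,
      of_apply]
    rw [Finset.sum_comm]
    exact Finset.sum_congr rfl fun i _ => Finset.sum_congr rfl fun j _ => by ring
  | succ m ih =>
    simp only [schrodinger, heisenberg, matElt_dualChannel, Matrix.sum_mul, Matrix.trace_sum, ih]

theorem posSemidef_schrodinger (K : ∀ m, ι m → ChainOperator n d) (m : ℕ) (x : ChainSpace n d) :
    (schrodinger K m x x).PosSemidef := by
  induction m generalizing x with
  | zero => exact posSemidef_vecMulVec_self_star x.ofLp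
  | succ m ih => exact posSemidef_sum _ fun a _ => ih _

end Evolution

/-! ### Matrix product form -/

section MatrixProduct

open Matrix

variable {n d : ℕ} {r : ℕ → ℕ} {ι : ℕ → Type}

/-- The component of `x` along the column `α` of `W` to the left of the cut after `m` spins. It is a
vector on the spins to the right of the cut, kept as a function of the whole configuration. -/
def bondCoord {m s : ℕ} (W : Matrix (LeftConfig n d m) (Fin s) ℂ) (x : ChainSpace n d) (α : Fin s)
    (i : SpinConfig n d) : ℂ :=
  ∑ b, star (W b α) * x (overwrite (fun k => (k : ℕ) < m) b i)

/-- The configuration of `m + 1` spins that extends `b` by the value `t` of the last one. -/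
def extendLeft {m : ℕ} (b : LeftConfig n d m) (t : Fin d) : LeftConfig n d (m + 1) :=
  fun k => if h : (k : ℕ) < m then b ⟨k, h⟩ else t

/-- The Kraus operator `κ m a` as a tensor between the bonds at the cuts `m` and `m + 1`: the matrix
`(W m)ᴴ (κ m a) ⟨t| W (m + 1)`, where `⟨t|` contracts the spin between the two cuts. -/
def krausTensor (W : ∀ m, Matrix (LeftConfig n d m) (Fin (r m)) ℂ)
    (κ : ∀ m, ι m → Matrix (LeftConfig n d m) (LeftConfig n d m) ℂ) (m : ℕ) (a : ι m) (t : Fin d) :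
    Matrix (Fin (r m)) (Fin (r (m + 1))) ℂ :=
  Matrix.of fun α β => ∑ b, ((W m)ᴴ * κ m a) α b * W (m + 1) (extendLeft b t) β

theorem eq_sum_bondCoord {m s : ℕ} (W : Matrix (LeftConfig n d m) (Fin s) ℂ) {x : ChainSpace n d}
    (hx : act (leftOp m (W * Wᴴ)) x = x) (i : SpinConfig n d) :
    x i = ∑ α, W (fun k => i k) α * bondCoord W x α i := by
  conv_lhs => rw [← hx]
  simp only [act, ofLp_toEuclideanCLM, leftOp, siteOp_mulVec, bondCoord, Matrix.mul_apply,
    conjTranspose_apply, Finset.sum_mul, Finset.mul_sum, mul_assoc]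
  rw [Finset.sum_comm]

theorem bondCoord_act {m s : ℕ} (W : Matrix (LeftConfig n d m) (Fin s) ℂ)
    (A : Matrix (LeftConfig n d m) (LeftConfig n d m) ℂ) (x : ChainSpace n d) (α : Fin s)
    (i : SpinConfig n d) :
    bondCoord W (act (leftOp m A) x) α i =
      ∑ b, (Wᴴ * A) α b * x (overwrite (fun k => (k : ℕ) < m) b i) := by
  simp only [act, ofLp_toEuclideanCLM, leftOp, siteOp_mulVec, bondCoord, Matrix.mul_apply,
    conjTranspose_apply, Finset.sum_mul, Finset.mul_sum, restrict_overwrite,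
    overwrite_overwrite_of_imp (fun k : Fin n => (k : ℕ) < m) (fun k : Fin n => (k : ℕ) < m)
      (fun _ h => h), mul_assoc]
  rw [Finset.sum_comm]

theorem bondCoord_overwrite {m s : ℕ} (W : Matrix (LeftConfig n d (m + 1)) (Fin s) ℂ)
    (x : ChainSpace n d) (β : Fin s) (b : LeftConfig n d m) (i : SpinConfig n d) :
    bondCoord W x β (overwrite (fun k => (k : ℕ) < m) b i) = bondCoord W x β i := by
  simp only [bondCoord]
  refine Finset.sum_congr rfl fun c _ => ?_
  rw [overwrite_overwrite_of_imp (fun k : Fin n => (k : ℕ) < m) (fun k : Fin n => (k : ℕ) < m + 1)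
    (fun _ h => Nat.lt_succ_of_lt h)]

theorem bondCoord_act_succ (W : ∀ m, Matrix (LeftConfig n d m) (Fin (r m)) ℂ)
    (κ : ∀ m, ι m → Matrix (LeftConfig n d m) (LeftConfig n d m) ℂ) {m : ℕ} (hm : m < n) (a : ι m)
    {x : ChainSpace n d} (hx : act (leftOp (m + 1) (W (m + 1) * (W (m + 1))ᴴ)) x = x)
    (α : Fin (r m)) (i : SpinConfig n d) :
    bondCoord (W m) (act (leftOp m (κ m a)) x) α i =
      ∑ β, krausTensor W κ m a (i ⟨m, hm⟩) α β * bondCoord (W (m + 1)) x β i := by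
  rw [bondCoord_act]
  have h : ∀ b : LeftConfig n d m, x (overwrite (fun k => (k : ℕ) < m) b i) =
      ∑ β, W (m + 1) (extendLeft b (i ⟨m, hm⟩)) β * bondCoord (W (m + 1)) x β i := fun b => by
    rw [eq_sum_bondCoord (W (m + 1)) hx]
    refine Finset.sum_congr rfl fun β _ => ?_
    rw [bondCoord_overwrite]
    congr 2
    funext k
    simp only [overwrite, extendLeft]
    split_ifs with hk
    · rfl
    · congr 1
      exact Fin.ext (by have := k.2; simp only; omega)
  simp only [h, krausTensor, of_apply, Finset.sum_mul, Finset.mul_sum, mul_assoc]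
  rw [Finset.sum_comm]

/-- The matrix product operator whose bond at the cut `m` carries the pairs of indices in
`Fin (r m)` and whose tensors are `∑ a, T a ⊗ conj (T a)` with `T` the tensors of the Kraus
operators. -/
noncomputable def krausMPO [∀ m, Fintype (ι m)]
    (W : ∀ m, Matrix (LeftConfig n d m) (Fin (r m)) ℂ)
    (κ : ∀ m, ι m → Matrix (LeftConfig n d m) (LeftConfig n d m) ℂ)
    (hr : ∀ m, 0 < r m) (h0 : r 0 = 1) (hn : r n = 1) : MatrixProductOperator n d where
  dim k := r k * r k
  dim_pos k := Nat.mul_pos (hr k) (hr k)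
  dim_first := by simp [h0]
  dim_last := by simp [hn]
  tensor k s t := Matrix.of fun p q => ∑ a,
    krausTensor W κ k a s (finProdFinEquiv.symm p).1 (finProdFinEquiv.symm q).1 *
      star (krausTensor W κ k a t (finProdFinEquiv.symm p).2 (finProdFinEquiv.symm q).2)

theorem sum_finProdFinEquiv_mul {s : ℕ} (f g : Fin s → ℂ) :
    ∑ q : Fin (s * s), f (finProdFinEquiv.symm q).1 * g (finProdFinEquiv.symm q).2 =
      (∑ α, f α) * ∑ β, g β := by
  rw [Finset.sum_mul_sum, ← Fintype.sum_prod_type' (f := fun α β => f α * g β)]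
  exact Equiv.sum_comp finProdFinEquiv.symm fun p : Fin s × Fin s => f p.1 * g p.2

/-- Each channel ends in the range of the projection at its cut, so a bond only has to carry the
coordinates of the two vectors with respect to the columns of `W`. -/
theorem schrodinger_eq_sum_partialProd [∀ m, Fintype (ι m)]
    (W : ∀ m, Matrix (LeftConfig n d m) (Fin (r m)) ℂ)
    (κ : ∀ m, ι m → Matrix (LeftConfig n d m) (LeftConfig n d m) ℂ)
    (hr : ∀ m, 0 < r m) (h0 : r 0 = 1) (hn : r n = 1)
    (hW : ∀ m, W m * (W m)ᴴ * W m = W m) (hκ : ∀ m a, W m * (W m)ᴴ * κ m a = κ m a)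
    (i j : SpinConfig n d) (k : Fin (n + 1)) (x y : ChainSpace n d)
    (hx : act (leftOp (k : ℕ) (W k * (W k)ᴴ)) x = x)
    (hy : act (leftOp (k : ℕ) (W k * (W k)ᴴ)) y = y) :
    schrodinger (fun m a => leftOp m (κ m a)) k x y i j =
      ∑ q : Fin (r k * r k), (krausMPO W κ hr h0 hn).partialProd i j k
          ⟨0, (krausMPO W κ hr h0 hn).dim_pos 0⟩ q *
        (bondCoord (W k) x (finProdFinEquiv.symm q).1 i *
          star (bondCoord (W k) y (finProdFinEquiv.symm q).2 j)) := by
  induction k using Fin.induction generalizing x y with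
  | zero =>
    have hs : Subsingleton (Fin (r 0)) := by rw [h0]; infer_instance
    have hs2 : Subsingleton (Fin (r 0 * r 0)) := by rw [h0, one_mul]; infer_instance
    let α : Fin (r 0) := ⟨0, hr 0⟩
    let b : LeftConfig n d 0 := fun k => i k
    have hb : ∀ c : LeftConfig n d 0, c = b := fun c =>
      funext fun k => absurd k.2 (Nat.not_lt_zero _)
    have hpp : ∀ q : Fin (r 0 * r 0), (krausMPO W κ hr h0 hn).partialProd i j 0
        ⟨0, (krausMPO W κ hr h0 hn).dim_pos 0⟩ q = 1 := fun q => by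
      rw [Subsingleton.elim q ⟨0, (krausMPO W κ hr h0 hn).dim_pos 0⟩]
      exact Matrix.one_apply_eq _
    have hw : W 0 b α * star (W 0 b α) * W 0 b α = W 0 b α := by
      have h := congrFun (congrFun (hW 0) b) α
      have : Subsingleton (LeftConfig n d 0) := ⟨fun c e => (hb c).trans (hb e).symm⟩
      rw [Matrix.mul_apply, Fintype.sum_subsingleton _ b, Matrix.mul_apply,
        Fintype.sum_subsingleton _ α, conjTranspose_apply] at h
      exact h
    have hxi : ∀ z : ChainSpace n d, act (leftOp 0 (W 0 * (W 0)ᴴ)) z = z → ∀ l,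
        z l = W 0 b α * bondCoord (W 0) z α l ∧ bondCoord (W 0) z α l = star (W 0 b α) * z l :=
      fun z hz l => by
      have : Subsingleton (LeftConfig n d 0) := ⟨fun c e => (hb c).trans (hb e).symm⟩
      constructor
      · rw [eq_sum_bondCoord (W 0) hz l, Fintype.sum_subsingleton _ α, hb fun k => l k]
      · rw [bondCoord, Fintype.sum_subsingleton _ b]
        refine congrArg (fun t => star (W 0 b α) * z.ofLp t) (funext fun k => ?_)
        simp [overwrite]
    refine Eq.trans ?_ (Finset.sum_congr rfl fun q _ => by rw [hpp q, one_mul]).symm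
    have hsum := sum_finProdFinEquiv_mul (fun β => bondCoord (W 0) x β i)
      fun β => star (bondCoord (W 0) y β j)
    refine Eq.trans ?_ hsum.symm
    rw [Fintype.sum_subsingleton _ α, Fintype.sum_subsingleton _ α]
    obtain ⟨hx1, hx2⟩ := hxi x hx i
    obtain ⟨hy1, hy2⟩ := hxi y hy j
    change x i * star (y j) = _
    -- The single column at the empty cut is a phase or zero; both give the identity below.
    have hw' : star (W 0 b α) * W 0 b α * star (W 0 b α) = star (W 0 b α) := by
      have := congrArg star hw
      simpa [mul_comm, mul_assoc, mul_left_comm] using this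
    conv_lhs => rw [hx1, hy1, star_mul']
    rw [hx2]
    linear_combination (x i * star (bondCoord (W 0) y α j)) * hw'
  | succ k ih =>
    have hrange : ∀ a (z : ChainSpace n d),
        act (leftOp (k : ℕ) (W k * (W k)ᴴ)) (act (leftOp (k : ℕ) (κ k a)) z) =
          act (leftOp (k : ℕ) (κ k a)) z := fun a z => by
      rw [← act_mul, ← leftOp_mul, hκ]
    have hprod : ∀ q, (krausMPO W κ hr h0 hn).partialProd i j k.succ
        ⟨0, (krausMPO W κ hr h0 hn).dim_pos 0⟩ q =
        ∑ p : Fin (r k * r k), (krausMPO W κ hr h0 hn).partialProd i j k.castSucc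
          ⟨0, (krausMPO W κ hr h0 hn).dim_pos 0⟩ p * ∑ a,
          krausTensor W κ k a (i k) (finProdFinEquiv.symm p).1 (finProdFinEquiv.symm q).1 *
          star (krausTensor W κ k a (j k) (finProdFinEquiv.symm p).2 (finProdFinEquiv.symm q).2) :=
      fun q => rfl
    have hleft : schrodinger (fun m a => leftOp m (κ m a)) k.succ x y i j =
        ∑ a, schrodinger (fun m a => leftOp m (κ m a)) k (act (leftOp (k : ℕ) (κ k a)) x)
          (act (leftOp (k : ℕ) (κ k a)) y) i j := by
      rw [Fin.val_succ, schrodinger, Matrix.sum_apply]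
    rw [hleft]
    have hstep : ∀ a, schrodinger (fun m a => leftOp m (κ m a)) k (act (leftOp (k : ℕ) (κ k a)) x)
          (act (leftOp (k : ℕ) (κ k a)) y) i j =
        ∑ p : Fin (r k * r k), ∑ q : Fin (r (k + 1) * r (k + 1)),
          (krausMPO W κ hr h0 hn).partialProd i j k.castSucc
            ⟨0, (krausMPO W κ hr h0 hn).dim_pos 0⟩ p *
          ((krausTensor W κ k a (i k) (finProdFinEquiv.symm p).1 (finProdFinEquiv.symm q).1 *
            bondCoord (W (k + 1)) x (finProdFinEquiv.symm q).1 i) *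
          star (krausTensor W κ k a (j k) (finProdFinEquiv.symm p).2 (finProdFinEquiv.symm q).2 *
            bondCoord (W (k + 1)) y (finProdFinEquiv.symm q).2 j)) := fun a => by
      refine (ih _ _ (hrange a x) (hrange a y)).trans ?_
      refine Finset.sum_congr rfl fun p _ => ?_
      rw [← Finset.mul_sum, sum_finProdFinEquiv_mul (fun β =>
          krausTensor W κ k a (i k) (finProdFinEquiv.symm p).1 β * bondCoord (W (k + 1)) x β i)
        (fun β => star (krausTensor W κ k a (j k) (finProdFinEquiv.symm p).2 β *
          bondCoord (W (k + 1)) y β j)), ← star_sum]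
      congr 2
      · exact bondCoord_act_succ W κ k.2 a hx _ i
      · exact congrArg star (bondCoord_act_succ W κ k.2 a hy _ j)
    refine Eq.trans ?_ (Finset.sum_congr rfl fun q _ => by rw [hprod q]).symm
    rw [Finset.sum_congr rfl fun a _ => hstep a]
    generalize (krausMPO W κ hr h0 hn).partialProd i j k.castSucc
      ⟨0, (krausMPO W κ hr h0 hn).dim_pos 0⟩ = f
    rw [Finset.sum_congr rfl fun a _ => Finset.sum_comm, Finset.sum_comm,
      Finset.sum_congr rfl fun q _ => Finset.sum_comm]
    simp only [Finset.sum_mul, Finset.mul_sum, star_mul']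
    have hring : ∀ u v w y z : ℂ, u * (v * w * (y * z)) = u * (v * y) * (w * z) := by
      intros; ring
    exact Finset.sum_congr rfl fun q _ => Finset.sum_congr rfl fun p _ =>
      Finset.sum_congr rfl fun a _ => hring _ _ _ _ _

theorem toOperator_krausMPO [∀ m, Fintype (ι m)]
    (W : ∀ m, Matrix (LeftConfig n d m) (Fin (r m)) ℂ)
    (κ : ∀ m, ι m → Matrix (LeftConfig n d m) (LeftConfig n d m) ℂ)
    (hr : ∀ m, 0 < r m) (h0 : r 0 = 1) (hn : r n = 1)
    (hW : ∀ m, W m * (W m)ᴴ * W m = W m) (hκ : ∀ m a, W m * (W m)ᴴ * κ m a = κ m a)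
    {x : ChainSpace n d} (hx1 : ‖x‖ = 1) (hx : act (leftOp n (W n * (W n)ᴴ)) x = x) :
    (krausMPO W κ hr h0 hn).toOperator = schrodinger (fun m a => leftOp m (κ m a)) n x x := by
  have hs : Subsingleton (Fin (r n)) := by rw [hn]; infer_instance
  have hs2 : Subsingleton (Fin (r n * r n)) := by rw [hn, one_mul]; infer_instance
  let α : Fin (r n) := ⟨0, hr n⟩
  have hconst : ∀ i j, bondCoord (W n) x α i = bondCoord (W n) x α j := fun i j => by
    refine Finset.sum_congr rfl fun b _ => ?_
    refine congrArg (fun t => star (W n b α) * x.ofLp t) (funext fun k => ?_)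
    simp [overwrite, k.2]
  have hxi : ∀ i, x i = W n (fun k => i k) α * bondCoord (W n) x α i := fun i => by
    rw [eq_sum_bondCoord (W n) hx i, Fintype.sum_subsingleton _ α]
  -- The state is `z • W n` with `W n` a single column, so `|z| = 1`.
  have hz : ∀ i, bondCoord (W n) x α i * star (bondCoord (W n) x α i) = 1 := fun i => by
    have h1 : inner ℂ x x = (1 : ℂ) := by rw [inner_self_eq_norm_sq_to_K, hx1]; simp
    rw [← h1, PiLp.inner_apply]
    conv_lhs => rw [mul_comm]; rhs; rw [bondCoord]
    rw [Finset.mul_sum]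
    symm
    refine Finset.sum_nbij' (fun j => fun k => j k)
      (fun b => overwrite (fun k => (k : ℕ) < n) b i) (by simp) (by simp)
      (fun j _ => overwrite_restrict _ i j fun k hk => absurd k.2 hk)
      (fun b _ => restrict_overwrite _ b i) fun j _ => ?_
    have hxj : star (x j) = star (W n (fun k => j k) α) * star (bondCoord (W n) x α i) := by
      rw [hxi j, hconst j i, star_mul']
    rw [overwrite_restrict _ i j fun k hk => absurd k.2 hk, RCLike.inner_apply,
      ← Complex.star_def, hxj]
    ring
  ext i j
  refine Eq.trans ?_
    (schrodinger_eq_sum_partialProd W κ hr h0 hn hW hκ i j (Fin.last n) x x hx hx).symm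
  refine Eq.trans ?_ (Fintype.sum_subsingleton _
    (⟨0, Nat.mul_pos (hr n) (hr n)⟩ : Fin (r n * r n))).symm
  have hα : ∀ β : Fin (r n), β = α := fun β => Subsingleton.elim _ _
  have h1 : ∀ p : Fin (r n) × Fin (r n), bondCoord (W n) x p.1 i *
      star (bondCoord (W n) x p.2 j) = 1 := fun p => by
    rw [hα p.1, hα p.2, hconst j i, hz]
  exact ((mul_one _).symm.trans (congrArg _ (h1 _).symm))

end MatrixProduct

/-! ### Bounds on matrix elements -/

section FormBounds

open Matrix

variable {n d : ℕ}

/-- All matrix elements of `Z` between unit vectors are at most `N`, i.e. the operator norm of `Z`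
is at most `N`. -/
def FormBound (N : ℝ) (Z : ChainOperator n d) : Prop :=
  ∀ x y : ChainSpace n d, ‖matElt x Z y‖ ≤ N * ‖x‖ * ‖y‖

theorem matElt_one_self (x : ChainSpace n d) : matElt x 1 x = ((‖x‖ ^ 2 : ℝ) : ℂ) := by
  rw [matElt_one, inner_self_eq_norm_sq_to_K]
  simp

theorem matElt_conj_symm (x y : ChainSpace n d) (Z : ChainOperator n d) :
    matElt x Z y = star (matElt y Zᴴ x) := by
  rw [matElt, matElt, ← inner_act_left, Complex.star_def, inner_conj_symm]

theorem sum_norm_act_sq {ι : Type} [Fintype ι] {K : ι → ChainOperator n d}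
    (hK : dualChannel K 1 = 1) (x : ChainSpace n d) : ∑ a, ‖act (K a) x‖ ^ 2 = ‖x‖ ^ 2 := by
  have h := matElt_dualChannel K 1 x x
  rw [hK] at h
  simp only [matElt_one_self] at h
  exact_mod_cast h.symm

theorem formBound_dualChannel {ι : Type} [Fintype ι] {K : ι → ChainOperator n d}
    (hK : dualChannel K 1 = 1) {N : ℝ} (hN : 0 ≤ N) {Z : ChainOperator n d} (hZ : FormBound N Z) :
    FormBound N (dualChannel K Z) := by
  intro x y
  rw [matElt_dualChannel]
  calc ‖∑ a, matElt (act (K a) x) Z (act (K a) y)‖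
      ≤ ∑ a, ‖matElt (act (K a) x) Z (act (K a) y)‖ := norm_sum_le _ _
    _ ≤ ∑ a, N * (‖act (K a) x‖ * ‖act (K a) y‖) :=
        Finset.sum_le_sum fun a _ => (hZ _ _).trans_eq (mul_assoc _ _ _)
    _ = N * ∑ a, ‖act (K a) x‖ * ‖act (K a) y‖ := (Finset.mul_sum _ _ _).symm
    _ ≤ N * (√(∑ a, ‖act (K a) x‖ ^ 2) * √(∑ a, ‖act (K a) y‖ ^ 2)) := by
        gcongr
        exact Real.sum_mul_le_sqrt_mul_sqrt _ _ _
    _ = N * ‖x‖ * ‖y‖ := by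
        rw [sum_norm_act_sq hK, sum_norm_act_sq hK, Real.sqrt_sq (norm_nonneg _),
          Real.sqrt_sq (norm_nonneg _), mul_assoc]

theorem FormBound.norm_matElt_sub_le {N : ℝ} {Z : ChainOperator n d} (hZ : FormBound N Z)
    (x y : ChainSpace n d) :
    ‖matElt x Z x - matElt y Z y‖ ≤ N * ‖y - x‖ * (‖x‖ + ‖y‖) := by
  have h : matElt x Z x - matElt y Z y = matElt x Z (x - y) + matElt (x - y) Z y := by
    simp only [matElt, act, map_sub, inner_sub_left, inner_sub_right]
    ring
  rw [h]
  refine (norm_add_le _ _).trans ((add_le_add (hZ _ _) (hZ _ _)).trans_eq ?_)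
  rw [norm_sub_rev x y]
  ring

end FormBounds

/-! ### The channel at one cut -/

section LocalChannel

open Matrix

variable {n d : ℕ}

/-- `Z` acts nontrivially only on the first `m` spins. -/
def IsLeft (m : ℕ) (Z : ChainOperator n d) : Prop :=
  ∃ A : Matrix (LeftConfig n d m) (LeftConfig n d m) ℂ, Z = leftOp m A

theorem IsLeft.mono {m m' : ℕ} (h : m ≤ m') {Z : ChainOperator n d} (hZ : IsLeft m Z) :
    IsLeft m' Z := by
  obtain ⟨A, rfl⟩ := hZ
  exact exists_siteOp_of_imp (fun _ hk => lt_of_lt_of_le hk h) A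

theorem isLeft_dualChannel {ι : Type} [Fintype ι] {m : ℕ} {K : ι → ChainOperator n d}
    (hK : ∀ a, IsLeft m (K a)) {Z : ChainOperator n d} (hZ : IsLeft m Z) :
    IsLeft m (dualChannel K Z) := by
  choose κ hκ using hK
  obtain ⟨A, rfl⟩ := hZ
  refine ⟨∑ a, (κ a)ᴴ * A * κ a, ?_⟩
  rw [leftOp_sum]
  refine Finset.sum_congr rfl fun a _ => ?_
  rw [hκ, leftOp_mul, leftOp_mul, leftOp_conjTranspose]

theorem matElt_eq_add_of_orthogonal {m : ℕ} {ψ p : ChainSpace n d}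
    (h : ∀ A, matElt p (leftOp m A) (ψ - p) = 0)
    (A : Matrix (LeftConfig n d m) (LeftConfig n d m) ℂ) :
    matElt ψ (leftOp m A) ψ =
      matElt p (leftOp m A) p + matElt (ψ - p) (leftOp m A) (ψ - p) := by
  have h2 : matElt (ψ - p) (leftOp m A) p = 0 := by
    rw [matElt_conj_symm, leftOp_conjTranspose, h, star_zero]
  have h3 : matElt ψ (leftOp m A) ψ = matElt p (leftOp m A) p + matElt p (leftOp m A) (ψ - p) +
      matElt (ψ - p) (leftOp m A) p + matElt (ψ - p) (leftOp m A) (ψ - p) := by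
    simp only [matElt, act, map_sub, inner_sub_left, inner_sub_right]
    ring
  rw [h3, h, h2]
  ring

theorem norm_sq_add_norm_sub_sq {m : ℕ} {ψ p : ChainSpace n d}
    (h : ∀ A, matElt p (leftOp m A) (ψ - p) = 0) :
    ‖p‖ ^ 2 + ‖ψ - p‖ ^ 2 = ‖ψ‖ ^ 2 := by
  have h1 := matElt_eq_add_of_orthogonal h 1
  rw [leftOp_one, matElt_one_self, matElt_one_self, matElt_one_self] at h1
  exact_mod_cast h1.symm

/-- The channel at the cut `m`. Here `p'` is the truncation of `ψ` at the cut `m + 1`, and that at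
the cut `m` is `P ψ`. On operators to the left of the cut, the channel turns expectations in `p'`,
normalised, into expectations in `P ψ`, normalised; and it moves the expectation of any observable
in `ψ` by an amount controlled by the two truncation errors. -/
theorem exists_local_channel {m : ℕ} {ψ p' : ChainSpace n d} (hψ : ‖ψ‖ = 1)
    {P : Matrix (LeftConfig n d m) (LeftConfig n d m) ℂ} (hP : Pᴴ = P) (hPP : P * P = P)
    (hp0 : act (leftOp m P) ψ ≠ 0)
    (horth : ∀ A, matElt p' (leftOp (m + 1) A) (ψ - p') = 0)
    (horthP : ∀ A, matElt (act (leftOp m P) ψ) (leftOp m A) (ψ - act (leftOp m P) ψ) = 0) :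
    ∃ (N : ℕ) (κ : Option (Fin N) → Matrix (LeftConfig n d m) (LeftConfig n d m) ℂ),
      (∀ a, P * κ a = κ a) ∧ dualChannel (fun a => leftOp m (κ a)) 1 = 1 ∧
      (∀ A, ((‖act (leftOp m P) ψ‖ ^ 2 : ℝ) : ℂ) *
          matElt p' (dualChannel (fun a => leftOp m (κ a)) (leftOp m A)) p' =
        ((‖p'‖ ^ 2 : ℝ) : ℂ) *
          matElt (act (leftOp m P) ψ) (leftOp m A) (act (leftOp m P) ψ)) ∧
      ∀ (M : ℝ) (Z : ChainOperator n d), 0 ≤ M → FormBound M Z →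
        ‖matElt ψ (dualChannel (fun a => leftOp m (κ a)) Z) ψ - matElt ψ Z ψ‖ ≤
          M * (2 * ‖ψ - p'‖ ^ 2 + 2 * ‖ψ - act (leftOp m P) ψ‖ +
            ‖ψ - act (leftOp m P) ψ‖ ^ 2) := by
  set p := act (leftOp m P) ψ with hp
  set s := ‖p'‖ ^ 2 with hs
  set t := ‖p‖ ^ 2 with ht
  have hs' : s + ‖ψ - p'‖ ^ 2 = 1 := by rw [hs, norm_sq_add_norm_sub_sq horth, hψ, one_pow]
  have ht' : t + ‖ψ - p‖ ^ 2 = 1 := by rw [ht, norm_sq_add_norm_sub_sq horthP, hψ, one_pow]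
  have ht0 : 0 < t := by have := norm_pos_iff.2 hp0; positivity
  have ht1 : t ≤ 1 := by nlinarith [sq_nonneg ‖ψ - p‖]
  have hs0 : 0 ≤ s := sq_nonneg _
  have hs1 : s ≤ 1 := by nlinarith [sq_nonneg ‖ψ - p'‖]
  have hPact : ∀ x : ChainSpace n d, act (leftOp m P) (act (leftOp m P) x) = act (leftOp m P) x :=
    fun x => by rw [← act_mul, ← leftOp_mul, hPP]
  have hPmat : ∀ A (x y : ChainSpace n d), matElt x (leftOp m (P * A * P)) y =
      matElt (act (leftOp m P) x) (leftOp m A) (act (leftOp m P) y) := fun A x y => by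
    rw [leftOp_mul, leftOp_mul, ← matElt_conj, leftOp_conjTranspose, hP]
  obtain ⟨N, κ, γ, hκ1, hκ2, hγ1, hκ3, hγ⟩ := exists_truncation_channel m hP hPP hs0 hs1 hp0
    (hPact ψ) (w₁ := ((√(1 / t - 1) : ℝ) : ℂ) • p) (w₂ := act (leftOp m P) (ψ - p'))
    (by rw [act, map_smul]; exact congrArg _ (hPact ψ)) (hPact _)
  -- The choice of `w₁` and `w₂`: `P` maps `p'` to `q` and the reduced state of `q` lies below
  -- that of `p`, the difference being that of `η`. The reset supplies `η` and the normalisation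
  -- of `p`.
  set η := act (leftOp m P) (ψ - p') with hη
  set q := act (leftOp m P) p' with hq
  have hdual : ∀ A, dualChannel (fun a => leftOp m (κ a)) (leftOp m A) =
      leftOp m ((s : ℂ) • (P * A * P) + γ A • (1 - (s : ℂ) • P)) := fun A => by
    rw [← hκ3, leftOp_sum]
    refine Finset.sum_congr rfl fun a _ => ?_
    rw [leftOp_mul, leftOp_mul, leftOp_conjTranspose]
  have hunital : dualChannel (fun a => leftOp m (κ a)) 1 = (1 : ChainOperator n d) := by
    have h := hdual 1
    rw [leftOp_one, Matrix.mul_one, hPP, hγ1, one_smul, add_sub_cancel, leftOp_one] at h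
    exact h
  have hPself : ∀ x : ChainSpace n d,
      matElt x (leftOp m P) x = ((‖act (leftOp m P) x‖ ^ 2 : ℝ) : ℂ) := fun x => by
    have h := hPmat 1 x x
    rwa [Matrix.mul_one, hPP, leftOp_one, matElt_one_self] at h
  have hsplit : ∀ A, matElt p (leftOp m A) p =
      matElt q (leftOp m A) q + matElt η (leftOp m A) η := fun A => by
    obtain ⟨B, hB⟩ := IsLeft.mono (Nat.le_succ m) ⟨P * A * P, rfl⟩
    have h := matElt_eq_add_of_orthogonal horth B
    rwa [← hB, hPmat, hPmat, hPmat] at h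
  have hnorm : t = ‖q‖ ^ 2 + ‖η‖ ^ 2 := by
    have h := hsplit 1
    rw [leftOp_one, matElt_one_self, matElt_one_self, matElt_one_self] at h
    exact_mod_cast h
  have hsmul : ∀ (c : ℝ) (x : ChainSpace n d) (Z : ChainOperator n d), 0 ≤ c →
      matElt (((√c : ℝ) : ℂ) • x) Z (((√c : ℝ) : ℂ) • x) = (c : ℂ) * matElt x Z x :=
    fun c x Z hc => by
    rw [matElt, act, map_smul, inner_smul_left, inner_smul_right, Complex.conj_ofReal, ← mul_assoc,
      ← Complex.ofReal_mul, Real.mul_self_sqrt hc]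
    rfl
  have hnsmul : ∀ (c : ℝ) (x : ChainSpace n d), 0 ≤ c →
      ‖((√c : ℝ) : ℂ) • x‖ ^ 2 = c * ‖x‖ ^ 2 := fun c x hc => by
    rw [norm_smul, mul_pow, Complex.norm_real, Real.norm_of_nonneg (Real.sqrt_nonneg _),
      Real.sq_sqrt hc]
  refine ⟨N, κ, hκ1, hunital, fun A => ?_, fun M Z hM hZ => ?_⟩
  · have hv0 : 0 ≤ 1 / t - 1 := by
      rw [sub_nonneg, le_div_iff₀ ht0]; linarith
    have hv : t * (1 / t - 1) = 1 - t := by field_simp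
    have hγA := hγ A
    rw [hsmul _ _ _ hv0, hnsmul _ _ hv0, ← ht,
      show (1 / t - 1) * t + ‖η‖ ^ 2 = 1 - ‖q‖ ^ 2 by linarith] at hγA
    have hvC : (t : ℂ) * ((1 / t - 1 : ℝ) : ℂ) = 1 - t := by exact_mod_cast hv
    rw [hdual, leftOp_add, leftOp_smul, leftOp_smul, leftOp_sub, leftOp_smul, leftOp_one,
      matElt_add, matElt_smul, matElt_smul, matElt_sub, matElt_smul, matElt_one_self, hPself, hPmat,
      ← hs, ← hq]
    push_cast at hγA hvC ⊢
    linear_combination (t * s : ℂ) * hγA - (t * s : ℂ) * hsplit A +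
      (s : ℂ) * matElt p (leftOp m A) p * hvC
  · have hnone : act (leftOp m (κ none)) ψ = ((√s : ℝ) : ℂ) • p := by
      rw [hκ2, leftOp_smul, act, map_smul]
      rfl
    have hsum := sum_norm_act_sq hunital ψ
    rw [Fintype.sum_option, hnone, hnsmul _ _ hs0, hψ, one_pow, ← ht] at hsum
    rw [matElt_dualChannel, Fintype.sum_option, hnone, hsmul _ _ _ hs0]
    have hR : ‖∑ j, matElt (act (leftOp m (κ (some j))) ψ) Z (act (leftOp m (κ (some j))) ψ)‖ ≤
        M * (1 - s * t) := by
      rw [← hsum, add_sub_cancel_left, Finset.mul_sum]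
      refine (norm_sum_le _ _).trans (Finset.sum_le_sum fun j _ => (hZ _ _).trans_eq ?_)
      ring
    have h1 := hZ.norm_matElt_sub_le p ψ
    have h2 := hZ p p
    have hpn : ‖p‖ ≤ 1 := by
      rw [← sq_le_one_iff₀ (norm_nonneg _)]; exact ht1
    generalize ∑ j, matElt (act (leftOp m (κ (some j))) ψ) Z
      (act (leftOp m (κ (some j))) ψ) = R at hR ⊢
    have h3 : (s : ℂ) * matElt p Z p + R - matElt ψ Z ψ =
        (matElt p Z p - matElt ψ Z ψ) - ((1 - s : ℝ) : ℂ) * matElt p Z p + R := by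
      push_cast; ring
    have h4 : ‖((1 - s : ℝ) : ℂ) * matElt p Z p‖ ≤ (1 - s) * M := by
      rw [norm_mul, Complex.norm_real, Real.norm_of_nonneg (sub_nonneg.2 hs1)]
      refine mul_le_mul_of_nonneg_left (h2.trans ?_) (sub_nonneg.2 hs1)
      rw [mul_assoc, ← sq]
      exact mul_le_of_le_one_right hM ht1
    have h5 : M * ‖ψ - p‖ * (‖p‖ + ‖ψ‖) ≤ M * ‖ψ - p‖ * 2 := by
      gcongr; linarith
    have h6 : M * (1 - s * t) ≤ M * (‖ψ - p'‖ ^ 2 + ‖ψ - p‖ ^ 2) := by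
      gcongr
      nlinarith [sq_nonneg ‖ψ - p‖]
    rw [h3]
    calc ‖(matElt p Z p - matElt ψ Z ψ) - ((1 - s : ℝ) : ℂ) * matElt p Z p + R‖
        ≤ ‖matElt p Z p - matElt ψ Z ψ‖ + ‖((1 - s : ℝ) : ℂ) * matElt p Z p‖ + ‖R‖ :=
          (norm_add_le _ _).trans (add_le_add_left (norm_sub_le _ _) _)
      _ ≤ M * ‖ψ - p‖ * 2 + (1 - s) * M + M * (‖ψ - p'‖ ^ 2 + ‖ψ - p‖ ^ 2) := by
          linarith
      _ = _ := by
          rw [show 1 - s = ‖ψ - p'‖ ^ 2 by linarith]; ring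

end LocalChannel

/-! ### Accuracy on local observables -/

section Assembly

open Matrix

variable {n d : ℕ}

theorem operatorNorm_nonneg (Z : ChainOperator n d) : 0 ≤ operatorNorm Z := norm_nonneg _

theorem dualChannel_eq_self_of_commute {ι : Type} [Fintype ι] {K : ι → ChainOperator n d}
    (hK : dualChannel K 1 = 1) {Z : ChainOperator n d} (h : ∀ a, Z * K a = K a * Z) :
    dualChannel K Z = Z := by
  have : dualChannel K Z = dualChannel K 1 * Z := by
    rw [dualChannel, dualChannel, Finset.sum_mul]
    refine Finset.sum_congr rfl fun a _ => ?_
    rw [mul_assoc, h, mul_one, mul_assoc]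
  rw [this, hK, one_mul]

theorem formBound_heisenberg {ι : ℕ → Type} [∀ m, Fintype (ι m)]
    {K : ∀ m, ι m → ChainOperator n d} (hK : ∀ m, dualChannel (K m) 1 = 1) {N : ℝ} (hN : 0 ≤ N)
    {Z : ChainOperator n d} (hZ : FormBound N Z) : ∀ m, FormBound N (heisenberg K m Z)
  | 0 => hZ
  | m + 1 => formBound_dualChannel (hK m) hN (formBound_heisenberg hK hN hZ m)

theorem heisenberg_eq_self {ι : ℕ → Type} [∀ m, Fintype (ι m)]
    {K : ∀ m, ι m → ChainOperator n d} (hK : ∀ m, dualChannel (K m) 1 = 1)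
    {Z : ChainOperator n d} {a : ℕ} (h : ∀ m < a, ∀ l, Z * K m l = K m l * Z) :
    ∀ m ≤ a, heisenberg K m Z = Z := by
  intro m hm
  induction m with
  | zero => rfl
  | succ m ih =>
    rw [heisenberg, ih (by omega), dualChannel_eq_self_of_commute (hK m) (h m (by omega))]

theorem isLeft_heisenberg {ι : ℕ → Type} [∀ m, Fintype (ι m)]
    {K : ∀ m, ι m → ChainOperator n d} (hK : ∀ m l, IsLeft m (K m l))
    {Z : ChainOperator n d} {b : ℕ} (hZ : IsLeft b Z) {m k : ℕ} (hb : b ≤ k) (hm : m ≤ k + 1) :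
    IsLeft k (heisenberg K m Z) := by
  induction m with
  | zero => exact hZ.mono hb
  | succ m ih =>
    exact isLeft_dualChannel (fun l => (hK m l).mono (by omega)) (ih (by omega))

/-- The error for an observable `Z` on the spins `a ≤ k < b`. Channels at cuts `m < a` do not
see `Z`, those at cuts from `b` on preserve the normalised truncations `p m`, and the `b - a`
channels in between are each close to the identity on `ψ`. -/
theorem norm_expectation_sub_trace_schrodinger_le {ι : ℕ → Type} [∀ m, Fintype (ι m)]
    {K : ∀ m, ι m → ChainOperator n d} {ψ : ChainSpace n d} {p : ℕ → ChainSpace n d} {δ : ℝ}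
    (hK : ∀ m l, IsLeft m (K m l)) (hK1 : ∀ m, dualChannel (K m) 1 = 1) (hp0 : ∀ m, p m ≠ 0)
    (hpn : p n = ψ) (hψ : ‖ψ‖ = 1) (hpsq : ∀ m, ‖p m‖ ^ 2 + ‖ψ - p m‖ ^ 2 = 1)
    (hδ : ∀ m ≤ n, ‖ψ - p m‖ ≤ δ)
    (hfix : ∀ m A, ((‖p m‖ ^ 2 : ℝ) : ℂ) *
        matElt (p (m + 1)) (dualChannel (K m) (leftOp m A)) (p (m + 1)) =
      ((‖p (m + 1)‖ ^ 2 : ℝ) : ℂ) * matElt (p m) (leftOp m A) (p m))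
    (hstep : ∀ m (M : ℝ) (Z : ChainOperator n d), 0 ≤ M → FormBound M Z →
      ‖matElt ψ (dualChannel (K m) Z) ψ - matElt ψ Z ψ‖ ≤
        M * (2 * ‖ψ - p (m + 1)‖ ^ 2 + 2 * ‖ψ - p m‖ + ‖ψ - p m‖ ^ 2))
    {a b : ℕ} (hab : a ≤ b) (hbn : b ≤ n) {Z : ChainOperator n d} (hZb : IsLeft b Z)
    (hZa : ∀ m < a, ∀ l, Z * K m l = K m l * Z) :
    ‖matElt ψ Z ψ - (schrodinger K n ψ ψ * Z).trace‖ ≤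
      (5 * (b - a : ℕ) + 3) * operatorNorm Z * δ := by
  set M := operatorNorm Z with hM
  have hM0 : 0 ≤ M := operatorNorm_nonneg Z
  have hZM : FormBound M Z := fun x y => norm_matElt_le x y Z
  have hΦ := formBound_heisenberg hK1 hM0 hZM
  have hsq : ∀ m ≤ n, ‖ψ - p m‖ ^ 2 ≤ δ := fun m hm => by
    have h1 : ‖ψ - p m‖ ≤ 1 := by
      rw [← sq_le_one_iff₀ (norm_nonneg _)]; nlinarith [hpsq m, sq_nonneg ‖p m‖]
    nlinarith [hδ m hm, norm_nonneg (ψ - p m)]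
  have hδ0 : 0 ≤ δ := (norm_nonneg _).trans (hδ 0 n.zero_le)
  -- Inside the window the expectation in `ψ` moves by at most `5 M δ` per channel.
  have hwin : ∀ j, a + j ≤ n →
      ‖matElt ψ Z ψ - matElt ψ (heisenberg K (a + j) Z) ψ‖ ≤ 5 * j * M * δ := by
    intro j
    induction j with
    | zero =>
      intro _
      rw [add_zero, heisenberg_eq_self hK1 hZa a le_rfl]
      simp
    | succ j ih =>
      intro hj
      have h1 := ih (by omega)
      have h2 := hstep (a + j) M _ hM0 (hΦ (a + j))
      have h3 := hδ (a + j) (by omega)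
      have h4 := hsq (a + j) (by omega)
      have h5 := hsq (a + j + 1) (by omega)
      have h6 : M * (2 * ‖ψ - p (a + j + 1)‖ ^ 2 + 2 * ‖ψ - p (a + j)‖ +
          ‖ψ - p (a + j)‖ ^ 2) ≤ M * (5 * δ) := by
        gcongr; linarith
      rw [norm_sub_rev] at h2
      have h7 := norm_add_le (matElt ψ Z ψ - matElt ψ (heisenberg K (a + j) Z) ψ)
        (matElt ψ (heisenberg K (a + j) Z) ψ -
          matElt ψ (dualChannel (K (a + j)) (heisenberg K (a + j) Z)) ψ)
      rw [sub_add_sub_cancel] at h7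
      rw [← add_assoc, heisenberg]
      push_cast
      linarith
  -- To the right of the window the normalised expectation in `p m` does not change.
  have hright : ∀ j, b + j ≤ n →
      ((‖p b‖ ^ 2 : ℝ) : ℂ) * matElt (p (b + j)) (heisenberg K (b + j) Z) (p (b + j)) =
        ((‖p (b + j)‖ ^ 2 : ℝ) : ℂ) * matElt (p b) (heisenberg K b Z) (p b) := by
    intro j
    induction j with
    | zero => intro _; rfl
    | succ j ih =>
      intro hj
      have h1 := ih (by omega)
      obtain ⟨A, hA⟩ := isLeft_heisenberg hK hZb (Nat.le_add_right b j) (Nat.le_succ (b + j))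
      have h2 := hfix (b + j) A
      rw [← hA] at h2
      rw [← add_assoc, heisenberg]
      have h3 : ((‖p (b + j)‖ ^ 2 : ℝ) : ℂ) ≠ 0 := by
        have := norm_pos_iff.2 (hp0 (b + j))
        exact_mod_cast (by positivity : ‖p (b + j)‖ ^ 2 ≠ 0)
      apply mul_left_cancel₀ h3
      linear_combination ((‖p b‖ ^ 2 : ℝ) : ℂ) * h2 +
        ((‖p (b + j + 1)‖ ^ 2 : ℝ) : ℂ) * h1
  have hlast := hright (n - b) (by omega)
  rw [Nat.add_sub_cancel' hbn, hpn, hψ] at hlast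
  have h1 := hwin (b - a) (by omega)
  rw [Nat.add_sub_cancel' hab] at h1
  rw [trace_schrodinger_mul]
  have h2 := (hΦ b).norm_matElt_sub_le (p b) ψ
  have h3 := hΦ n ψ ψ
  rw [hψ] at h3
  set X := matElt ψ (heisenberg K n Z) ψ
  have h4 : matElt ψ Z ψ - X = (matElt ψ Z ψ - matElt ψ (heisenberg K b Z) ψ) -
      (matElt (p b) (heisenberg K b Z) (p b) - matElt ψ (heisenberg K b Z) ψ) -
      ((‖ψ - p b‖ ^ 2 : ℝ) : ℂ) * X := by
    have h5 : ((‖p b‖ ^ 2 : ℝ) : ℂ) = 1 - ((‖ψ - p b‖ ^ 2 : ℝ) : ℂ) := by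
      rw [eq_sub_iff_add_eq, ← Complex.ofReal_add, hpsq b, Complex.ofReal_one]
    rw [h5] at hlast
    push_cast at hlast ⊢
    linear_combination -hlast
  have h5 : ‖((‖ψ - p b‖ ^ 2 : ℝ) : ℂ) * X‖ ≤ δ * M := by
    rw [norm_mul, Complex.norm_real, Real.norm_of_nonneg (sq_nonneg _)]
    exact mul_le_mul (hsq b hbn) (by linarith) (norm_nonneg _) hδ0
  have h6 : ‖p b‖ ≤ 1 := by
    rw [← sq_le_one_iff₀ (norm_nonneg _)]; nlinarith [hpsq b, sq_nonneg ‖ψ - p b‖]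
  have h7 : M * ‖ψ - p b‖ * (‖p b‖ + ‖ψ‖) ≤ M * δ * 2 := by
    have := hδ b hbn
    gcongr
    linarith
  rw [h4]
  have h8 := norm_sub_le ((matElt ψ Z ψ - matElt ψ (heisenberg K b Z) ψ) -
      (matElt (p b) (heisenberg K b Z) (p b) - matElt ψ (heisenberg K b Z) ψ))
      (((‖ψ - p b‖ ^ 2 : ℝ) : ℂ) * X)
  have h9 := norm_sub_le (matElt ψ Z ψ - matElt ψ (heisenberg K b Z) ψ)
      (matElt (p b) (heisenberg K b Z) (p b) - matElt ψ (heisenberg K b Z) ψ)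
  linarith

theorem IsLocalOperator.isLeft {ℓ : ℕ} {O : ChainOperator n d} {a : ℕ}
    {o : Matrix ((Finset.univ.filter fun k : Fin n => a ≤ (k : ℕ) ∧ (k : ℕ) < a + ℓ :
        Finset (Fin n)) → Fin d)
      ((Finset.univ.filter fun k : Fin n => a ≤ (k : ℕ) ∧ (k : ℕ) < a + ℓ :
        Finset (Fin n)) → Fin d) ℂ} (hO : O = extendOperator _ o) :
    IsLeft (min (a + ℓ) n) O := by
  obtain ⟨A, hA⟩ := exists_siteOp_of_imp (q := fun k : Fin n => (k : ℕ) < min (a + ℓ) n)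
    (fun k hk => lt_min (Finset.mem_filter.1 hk).2.2 k.2) o
  exact ⟨A, hO.trans hA⟩

end Assembly

theorem mainTheorem5 (d : ℕ) :
    ∃ C : ℕ → ℝ, ∀ (n D : ℕ), 1 ≤ D → ∀ ψ : ChainSpace n d, ‖ψ‖ = 1 →
      ∃ ρ : MatrixProductOperator n d,
        ρ.bondDim ≤ D ^ 2 ∧ (2 ≤ n → ρ.bondDim = D ^ 2) ∧
        ρ.toOperator.PosSemidef ∧
        ∀ (ℓ : ℕ) (O : ChainOperator n d), IsLocalOperator ℓ O →
          ‖expectation ψ O - (ρ.toOperator * O).trace‖ ≤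
            C ℓ * operatorNorm O * √(truncationError ψ D) := by
  refine ⟨fun ℓ => 5 * ℓ + 3, fun n D hD ψ hψ => ?_⟩
  have hψ0 : ψ ≠ 0 := fun h => by simp [h] at hψ
  have hr := one_le_keptRank (n := n) hD
  have hr0 : keptRank n D 0 = 1 := if_pos (Or.inl rfl)
  have hrn : keptRank n D n = 1 := if_pos (Or.inr rfl)
  choose W hW horth htail hp0 using fun m => exists_cut_truncation ψ hψ0 m (hr m)
  have hPh : ∀ m, (W m * (W m).conjTranspose).conjTranspose = W m * (W m).conjTranspose :=
    fun m => by rw [Matrix.conjTranspose_mul, Matrix.conjTranspose_conjTranspose]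
  have hPP : ∀ m, W m * (W m).conjTranspose * (W m * (W m).conjTranspose) =
      W m * (W m).conjTranspose := fun m => by rw [← Matrix.mul_assoc, hW]
  choose N κ hκP hκ1 hfix hstep using fun m =>
    exists_local_channel hψ (hPh m) (hPP m) (hp0 m) (horth (m + 1)) (horth m)
  have hδ : ∀ m ≤ n, ‖ψ - act (leftOp m (W m * (W m).conjTranspose)) ψ‖ ≤
      √(truncationError ψ D) := fun m hm =>
    Real.le_sqrt_of_sq_le ((htail m).trans_le (schmidtTail_keptRank_le ψ hm D))
  have hpn : act (leftOp n (W n * (W n).conjTranspose)) ψ = ψ := by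
    have h := (htail n).trans ((congrArg (schmidtTail ψ n) hrn).trans
      (schmidtTail_one_of_trivial_cut ψ (Or.inr rfl)))
    exact (sub_eq_zero.1 (norm_eq_zero.1 (sq_eq_zero_iff.1 h))).symm
  have hρ := toOperator_krausMPO W κ hr hr0 hrn hW hκP hψ hpn
  have hdim : ∀ k : Fin (n + 1), keptRank n D k * keptRank n D k ≤ D ^ 2 := fun k => by
    rw [sq]
    have : keptRank n D k ≤ D := by unfold keptRank; split_ifs <;> omega
    exact Nat.mul_le_mul this this
  have hbond : (krausMPO W κ hr hr0 hrn).bondDim ≤ D ^ 2 := Finset.sup_le fun k _ => hdim k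
  refine ⟨krausMPO W κ hr hr0 hrn, hbond, fun hn => le_antisymm hbond ?_, ?_, ?_⟩
  · refine le_trans ?_ (Finset.le_sup (f := (krausMPO W κ hr hr0 hrn).dim)
      (Finset.mem_univ (⟨1, by omega⟩ : Fin (n + 1))))
    change D ^ 2 ≤ keptRank n D 1 * keptRank n D 1
    rw [keptRank, if_neg (by omega), sq]
  · rw [hρ]
    exact posSemidef_schrodinger _ n ψ
  · rintro ℓ O ⟨a, o, hO⟩
    rw [hρ]
    have h := norm_expectation_sub_trace_schrodinger_le
      (K := fun m l => leftOp m (κ m l))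
      (p := fun m => act (leftOp m (W m * (W m).conjTranspose)) ψ)
      (fun m l => ⟨_, rfl⟩) hκ1 hp0 hpn hψ
      (fun m => by rw [norm_sq_add_norm_sub_sq (horth m), hψ, one_pow]) hδ hfix hstep
      (a := min a n) (b := min (a + ℓ) n) (by omega) (min_le_right _ _)
      (IsLocalOperator.isLeft hO) (fun m hm l => by
        rw [hO, extendOperator_eq_siteOp]
        refine siteOp_commute (fun k hk => ?_) _ _
        have := (Finset.mem_filter.1 hk).2.1
        omega)
    refine h.trans ?_
    have hle : ((min (a + ℓ) n - min a n : ℕ) : ℝ) ≤ ℓ := by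
      exact_mod_cast (by omega : min (a + ℓ) n - min a n ≤ ℓ)
    have := operatorNorm_nonneg O
    beta_reduce
    gcongr
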